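/- Let $R$ and $S$ be complete, separated two-sided linear topological rings (associative and unital; the open two-sided ideals form a base of neighbourhoods of zero) with countable bases of neighbourhoods of zero, and let $f\colon R\to S$ be a continuous ring homomorphism that is *strongly right taut*: the open two-sided ideals $I\subset R$ for which the closure in $S$ of the right ideal $f(I)S$ is an open two-sided ideal of $S$ form a base of neighbourhoods of zero in $R$. For a set $X$, let $R[[X]]$ be the set of formal sums $\sum_{x\in X}r_x x$ whose family of coefficients $r_x\in R$ converges to zero. A left $R$-contramodule is an algebra $P$ over the monad $X\mapsto R[[X]]$ on the category of sets, with contraaction map $\pi_P\colon R[[P]]\to P$; it has an underlying left $R$-module. For an open right ideal or an open two-sided ideal $I\subset R$, let $I\rightthreetimes P\subset P$ be the image under $\pi_P$ of the formal sums with coefficients in $I$. The contramodule $P$ is separated if $\bigcap_I (I\rightthreetimes P)=0$, where $I$ ranges over the open right ideals of $R$. Restriction of scalars along $f$ (composition of the contraaction with $R[[Q]]\to S[[Q]]$) defines a functor $f_\sharp$ from separated left $S$-contramodules to separated left $R$-contramodules. The ring $S$ is a left $S$-contramodule (with infinite sums taken in its topology), hence also a left $R$-contramodule; for a left $R$-contramodule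 $P$, let $\operatorname{Hom}^R(S,P)$ be the set of left $R$-contramodule morphisms $S\to P$, with the left $S$-module structure given by pointwise addition and $(sg)(t)=g(ts)$. Then every set $\operatorname{Hom}^R(S,P)$, where $P$ is a separated left $R$-contramodule, can be given the structure of a separated left $S$-contramodule, functorially in $P$ (with respect to composition with morphisms $P\to P'$), so that the following hold. 1. The underlying left $S$-module of this contramodule is $\operatorname{Hom}^R(S,P)$ with the left $S$-module structure above. 2. There exist descending chains of open two-sided ideals $(I_n)_{n\ge 0}$ in $R$ and $(J_n)_{n\ge0}$ in $S$, forming bases of neighbourhoods of zero, such that $J_n$ is the closure of $f(I_n)S$ for every $n$. For any such chains, put $R_n=R/I_n$, $S_n=S/J_n$ and $P_n=P/(I_n\rightthreetimes P)$. Then the maps $\operatorname{Hom}^R(S,P)\to\operatorname{Hom}_{R_n}(S_n,P_n)$ induced by passage to the quotients are well defined, they are morphisms of left $S$-contramodules (a left $S_n$-module being viewed as a left $S$-contramodule), and they identify $\operatorname{Hom}^R(S,P)$ with $\varprojlim_n\operatorname{Hom}_{R_n}(S_n,P_n)$. 3. The resulting functor $P\mapsto\operatorname{Hom}^R(S,P)$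 from separated left $R$-contramodules to separated left $S$-contramodules is right adjoint to $f_\sharp$, by an adjunction whose counit is the map $\operatorname{Hom}^R(S,P)\to\operatorname{Hom}^R(R,P)\simeq P$ induced by the left $R$-contramodule morphism $f\colon R\to S$; that is, the counit takes $h$ to $h(1)$. -/

import Mathlib

open Filter Topology CategoryTheory MulOpposite

universe u v

noncomputable section

namespace Contramodules

/-! ### Zero-convergent families and infinite sums -/

/-- `FormalSum A X` is the abelian group `A[[X]]` of infinite formal linear combinations
`∑ aₓ x` of elements of `X` whose family of coefficients converges to zero in `A`: for every
neighbourhood `U` of zero, all but finitely many of the `aₓ` lie in `U`. -/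
def FormalSum (A : Type u) [AddCommGroup A] [TopologicalSpace A] [IsTopologicalAddGroup A]
    (X : Type v) : AddSubgroup (X → A) where
  carrier := {a | Tendsto a cofinite (𝓝 0)}
  zero_mem' := tendsto_const_nhds
  add_mem' {a b} ha hb := by
    have : Tendsto (fun x => a x + b x) cofinite (𝓝 (0 + 0)) := Tendsto.add ha hb
    rwa [add_zero] at this
  neg_mem' {a} ha := by
    have : Tendsto (fun x => - a x) cofinite (𝓝 (-0)) := Tendsto.neg ha
    rwa [neg_zero] at this

theorem nonarchimedean_of_linear (R : Type u) [Ring R] [TopologicalSpace R] [IsTopologicalRing R]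
    [IsLinearTopology Rᵐᵒᵖ R] : NonarchimedeanAddGroup R where
  is_nonarchimedean U hU := by
    obtain ⟨N, hN, hNU⟩ := (IsLinearTopology.hasBasis_open_submodule Rᵐᵒᵖ).mem_iff.1 hU
    exact ⟨⟨N.toAddSubgroup, hN⟩, hNU⟩

/-- Auxiliary: topological left `R`-modules in which `∑ rₓ mₓ` converges for every zero-convergent
family `r` of elements of `R` and every family `m`. -/
structure Summing (R : Type u) [Ring R] [TopologicalSpace R]
    (M : Type v) [AddCommGroup M] [Module R M] [UniformSpace M] : Prop where
  nonarch : NonarchimedeanAddGroup M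
  unif : ∀ U ∈ 𝓝 (0 : M), ∃ V ∈ 𝓝 (0 : R), ∀ r ∈ V, ∀ m : M, r • m ∈ U
  cont : ∀ r : R, Continuous fun m : M => r • m

section Summing

variable {R : Type u} [Ring R] [UniformSpace R] [IsUniformAddGroup R] [IsTopologicalRing R]
  {M : Type v} [AddCommGroup M] [Module R M] [UniformSpace M] [IsUniformAddGroup M]
  [CompleteSpace M] [T2Space M] {X Y : Type*}

theorem Summing.tendsto (H : Summing R M) (a : FormalSum R X) (m : X → M) :
    Tendsto (fun x => a.1 x • m x) cofinite (𝓝 0) := by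
  intro U hU
  obtain ⟨V, hV, h⟩ := H.unif U hU
  exact mem_map.2 (mem_of_superset (show {x | a.1 x ∈ V} ∈ cofinite from a.2 hV)
    fun x hx => h (a.1 x) hx (m x))

theorem Summing.tendsto_prod (H : Summing R M) (a : FormalSum R X) (F : X → Y → M)
    (hF : ∀ x, Tendsto (F x) cofinite (𝓝 0)) :
    Tendsto (fun p : X × Y => a.1 p.1 • F p.1 p.2) cofinite (𝓝 0) := by
  intro U hU
  obtain ⟨V, hV, h⟩ := H.unif U hU
  have h1 : {x | a.1 x ∉ V}.Finite := a.2 hV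
  have h2 : ∀ x, {y | a.1 x • F x y ∉ U}.Finite := fun x => by
    have : Tendsto (fun y => a.1 x • F x y) cofinite (𝓝 (a.1 x • 0)) :=
      ((H.cont (a.1 x)).tendsto 0).comp (hF x)
    rw [smul_zero] at this
    exact this hU
  refine (h1.biUnion (t := fun x => (fun y => (x, y)) '' {y | a.1 x • F x y ∉ U})
    fun x _ => (h2 x).image _).subset ?_
  rintro ⟨x, y⟩ hxy
  have hxy' : a.1 x • F x y ∉ U := hxy
  simp only [Set.mem_iUnion]
  exact ⟨x, fun hx => hxy' (h _ hx _), y, hxy', rfl⟩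

theorem Summing.summable (H : Summing R M) {m : X → M} (h : Tendsto m cofinite (𝓝 0)) :
    Summable m :=
  have := H.nonarch
  NonarchimedeanAddGroup.summable_of_tendsto_cofinite_zero h

theorem Summing.tendsto_tsum (H : Summing R M) (a : FormalSum R X) (F : X → Y → M)
    (hF : ∀ x, Tendsto (F x) cofinite (𝓝 0)) :
    Tendsto (fun y => ∑' x, a.1 x • F x y) cofinite (𝓝 0) := by
  intro U hU
  have := H.nonarch
  obtain ⟨W, hW⟩ := NonarchimedeanAddGroup.is_nonarchimedean U hU
  have h1 := H.tendsto_prod a F hF (W.mem_nhds_zero)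
  refine ((show Set.Finite _ from h1).image Prod.snd).subset ?_
  intro y hy
  by_contra hcon
  apply hy
  apply hW
  have hmem : ∀ x, a.1 x • F x y ∈ W := fun x => by
    by_contra hx
    exact hcon ⟨(x, y), hx, rfl⟩
  have hs : HasSum (fun x => a.1 x • F x y) (∑' x, a.1 x • F x y) :=
    (H.summable (H.tendsto a fun x => F x y)).hasSum
  have hcl : IsClosed (W : Set M) := W.isClosed
  exact hcl.mem_of_tendsto hs (Eventually.of_forall fun s => sum_mem fun x _ => hmem x)

theorem Summing.tsum_comm (H : Summing R M) (a : FormalSum R X) (F : X → Y → M)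
    (hF : ∀ x, Tendsto (F x) cofinite (𝓝 0)) :
    ∑' y, ∑' x, a.1 x • F x y = ∑' x, a.1 x • ∑' y, F x y := by
  have h1 : Summable (Function.uncurry fun x y => a.1 x • F x y) :=
    H.summable (H.tendsto_prod a F hF)
  have h2 : ∀ x, Summable fun y => a.1 x • F x y := fun x => by
    apply H.summable
    have := ((H.cont (a.1 x)).tendsto 0).comp (hF x)
    rwa [smul_zero] at this
  have h3 : ∀ y, Summable fun x => a.1 x • F x y := fun y =>
    H.summable (H.tendsto a fun x => F x y)
  rw [h1.tsum_comm' h2 h3]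
  exact tsum_congr fun x =>
    ((H.summable (hF x)).map_tsum (DistribSMul.toAddMonoidHom M (a.1 x)) (H.cont (a.1 x))).symm

end Summing

/-! ### The monad `X ↦ R[[X]]` -/

section Monad

variable (R : Type u) [Ring R] [UniformSpace R] [IsUniformAddGroup R] [IsTopologicalRing R]
  [IsLinearTopology Rᵐᵒᵖ R]

theorem summing_self : Summing R R where
  nonarch := nonarchimedean_of_linear R
  unif U hU := by
    obtain ⟨N, hN, hNU⟩ := (IsLinearTopology.hasBasis_open_submodule Rᵐᵒᵖ).mem_iff.1 hU
    exact ⟨N, hN.mem_nhds N.zero_mem, fun r hr m => hNU (N.smul_mem (op m) hr)⟩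
  cont r := continuous_const_mul r

variable {R} [CompleteSpace R] [T2Space R] {X Y Z : Type*}

namespace FormalSum

/-- The unit `X → R[[X]]`, taking `x` to the formal linear combination `1 x`. -/
def single (x : X) : FormalSum R X :=
  ⟨fun y => open Classical in if y = x then 1 else 0, by
    refine Tendsto.congr' ?_ tendsto_const_nhds
    refine mem_of_superset (Set.finite_singleton x).compl_mem_cofinite fun y hy => ?_
    exact (if_neg hy).symm⟩

/-- Auxiliary: `∑ₓ aₓ (k x)`. -/
def bind (a : FormalSum R X) (k : X → FormalSum R Y) : FormalSum R Y :=
  ⟨fun y => ∑' x, a.1 x * (k x).1 y,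
    (summing_self R).tendsto_tsum a (fun x => (k x).1) fun x => (k x).2⟩

theorem fiber_tsum (a : FormalSum R X) (f : X → Y) (y : Y) :
    ∑' x : {x // f x = y}, a.1 x = (bind a fun x => single (f x)).1 y := by
  refine (tsum_subtype {x | f x = y} a.1).trans (tsum_congr fun x => ?_)
  by_cases h : f x = y
  · rw [Set.indicator_of_mem (show x ∈ {x | f x = y} from h)]
    simp [single, h]
  · rw [Set.indicator_of_notMem (show x ∉ {x | f x = y} from h)]
    have h' : y ≠ f x := fun e => h e.symm
    simp [single, h']

/-- The map `R[[f]] : R[[X]] → R[[Y]]` induced by `f : X → Y`, taking `∑ₓ aₓ x` to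
`∑ᵧ bᵧ y` with `bᵧ = ∑_{f x = y} aₓ`. -/
def map (f : X → Y) (a : FormalSum R X) : FormalSum R Y :=
  ⟨fun y => ∑' x : {x // f x = y}, a.1 x, by
    rw [show (fun y => ∑' x : {x // f x = y}, a.1 x) = (bind a fun x => single (f x)).1 from
      funext fun y => fiber_tsum a f y]
    exact (bind a fun x => single (f x)).2⟩

/-- The opening of parentheses `R[[R[[X]]]] → R[[X]]`. -/
def join (z : FormalSum R (FormalSum R X)) : FormalSum R X :=
  ⟨fun x => ∑' a : FormalSum R X, z.1 a * a.1 x,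
    (summing_self R).tendsto_tsum z (fun a => a.1) fun a => a.2⟩

theorem map_eq_bind (f : X → Y) (a : FormalSum R X) : map f a = bind a fun x => single (f x) :=
  Subtype.ext (funext fun y => fiber_tsum a f y)

theorem tsum_single {M : Type*} [AddCommGroup M] [Module R M] [TopologicalSpace M] [T2Space M]
    (x : X) (m : X → M) : ∑' y, (single (R := R) x).1 y • m y = m x := by
  rw [tsum_eq_single x fun y hy => by simp [single, hy]]
  simp [single]

theorem tsum_bind {M : Type*} [AddCommGroup M] [Module R M] [UniformSpace M]
    [IsUniformAddGroup M] [CompleteSpace M] [T2Space M] (H : Summing R M)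
    (a : FormalSum R X) (k : X → FormalSum R Y) (m : Y → M) :
    ∑' y, (bind a k).1 y • m y = ∑' x, a.1 x • ∑' y, (k x).1 y • m y := by
  rw [← H.tsum_comm a (fun x y => (k x).1 y • m y) fun x => H.tendsto (k x) m]
  refine tsum_congr fun y => ?_
  have hc : Continuous fun r : R => r • m y := by
    refine continuous_of_continuousAt_zero ((AddMonoidHom.mk' (fun r : R => r • m y)
      fun r s => add_smul r s _)) ?_
    intro U hU
    rw [_root_.map_zero] at hU
    obtain ⟨V, hV, h⟩ := H.unif U hU
    exact mem_map.2 (mem_of_superset hV fun r hr => h r hr (m y))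
  have h2 := ((summing_self R).summable
    ((summing_self R).tendsto a fun x => (k x).1 y)).map_tsum
      (AddMonoidHom.mk' (fun r : R => r • m y) fun r s => add_smul r s _) hc
  simp only [AddMonoidHom.mk'_apply, smul_eq_mul, mul_smul] at h2
  exact h2

theorem bind_bind (a : FormalSum R X) (k : X → FormalSum R Y) (l : Y → FormalSum R Z) :
    bind (bind a k) l = bind a fun x => bind (k x) l :=
  Subtype.ext (funext fun z => tsum_bind (summing_self R) a k fun y => (l y).1 z)

theorem single_bind (x : X) (k : X → FormalSum R Y) : bind (single x) k = k x :=
  Subtype.ext (funext fun y => tsum_single (R := R) x fun x => (k x).1 y)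

theorem bind_single (a : FormalSum R X) : bind a single = a := by
  refine Subtype.ext (funext fun y => ?_)
  change ∑' x, a.1 x * (single x).1 y = a.1 y
  rw [tsum_eq_single y fun x hx => by simp [single, hx.symm]]
  simp [single]

theorem join_eq_bind (z : FormalSum R (FormalSum R X)) : join z = bind z id := rfl

theorem map_id (a : FormalSum R X) : map id a = a := by
  rw [map_eq_bind]; exact bind_single a

theorem map_map (g : Y → Z) (f : X → Y) (a : FormalSum R X) :
    map g (map f a) = map (g ∘ f) a := by
  simp only [map_eq_bind, bind_bind, single_bind, Function.comp]

theorem map_single (f : X → Y) (x : X) : map f (single (R := R) x) = single (f x) := by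
  rw [map_eq_bind, single_bind]

theorem join_map (k : X → FormalSum R Y) (a : FormalSum R X) : join (map k a) = bind a k := by
  simp only [map_eq_bind, join_eq_bind, bind_bind, single_bind, id]

theorem bind_add (a b : FormalSum R X) (k : X → FormalSum R Y) :
    bind (a + b) k = bind a k + bind b k := by
  refine Subtype.ext (funext fun y => ?_)
  change ∑' x, (a.1 x + b.1 x) * (k x).1 y = _
  simp only [add_mul]
  have h := fun c : FormalSum R X => (summing_self R).summable
    ((summing_self R).tendsto c fun x => (k x).1 y)
  exact (h a).tsum_add (h b)

theorem map_add (f : X → Y) (a b : FormalSum R X) : map f (a + b) = map f a + map f b := by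
  simp only [map_eq_bind, bind_add]

theorem map_zero (f : X → Y) : map f (0 : FormalSum R X) = 0 := by
  have := map_add f (0 : FormalSum R X) 0
  simpa using this

theorem map_neg (f : X → Y) (a : FormalSum R X) : map f (-a) = -map f a := by
  have := map_add f (-a) a
  rw [neg_add_cancel, map_zero] at this
  exact eq_neg_of_add_eq_zero_left this.symm

/-- The left `R`-module structure on `R[[X]]`, given by `r ∑ aₓ x = ∑ (r aₓ) x`. -/
instance : Module R (FormalSum R X) where
  smul r a := ⟨fun x => r * a.1 x, by
    have := ((summing_self R).cont r).tendsto 0 |>.comp a.2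
    rwa [smul_zero] at this⟩
  one_smul a := Subtype.ext (funext fun x => one_mul _)
  mul_smul r s a := Subtype.ext (funext fun x => mul_assoc _ _ _)
  smul_zero r := Subtype.ext (funext fun x => mul_zero _)
  smul_add r a b := Subtype.ext (funext fun x => mul_add _ _ _)
  add_smul r s a := Subtype.ext (funext fun x => add_mul _ _ _)
  zero_smul a := Subtype.ext (funext fun x => zero_mul _)

theorem smul_apply (r : R) (a : FormalSum R X) (x : X) : (r • a).1 x = r * a.1 x := rfl

theorem map_smul (f : X → Y) (r : R) (a : FormalSum R X) : map f (r • a) = r • map f a := by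
  simp only [map_eq_bind]
  refine Subtype.ext (funext fun y => ?_)
  change ∑' x, (r * a.1 x) * (single (f x)).1 y = r * ∑' x, a.1 x * (single (f x)).1 y
  simp only [mul_assoc]
  exact (((summing_self R).summable
    ((summing_self R).tendsto a fun x => (single (f x)).1 y)).map_tsum
    (AddMonoidHom.mulLeft r) (continuous_const_mul r)).symm

end FormalSum

end Monad

/-! ### Contramodules -/

section Contra

variable (R : Type u) [Ring R] [UniformSpace R] [IsUniformAddGroup R] [IsTopologicalRing R]
  [IsLinearTopology Rᵐᵒᵖ R] [CompleteSpace R] [T2Space R]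

/-- A left `R`-contramodule structure on a set `P`, that is, a structure of algebra over the
monad `X ↦ R[[X]]`: a contraaction map satisfying contraunitality and contraassociativity. -/
structure ContraStr (P : Type v) where
  act : FormalSum R P → P
  act_single : ∀ p : P, act (FormalSum.single p) = p
  act_join : ∀ z : FormalSum R (FormalSum R P), act (FormalSum.join z) = act (FormalSum.map act z)

/-- A left `R`-contramodule. -/
structure Contra where
  carrier : Type v
  str : ContraStr R carrier

namespace Contra

variable {R}

instance : CoeSort (Contra.{u, v} R) (Type v) := ⟨carrier⟩

/-- The contraaction map `R[[P]] → P`. -/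
def act (P : Contra.{u, v} R) : FormalSum R P → P := P.str.act

/-- A morphism of left `R`-contramodules. -/
@[ext]
structure Hom (P Q : Contra.{u, v} R) where
  toFun : P → Q
  map_act : ∀ a : FormalSum R P, toFun (P.act a) = Q.act (FormalSum.map toFun a)

/-- The category of left `R`-contramodules. -/
instance : Category (Contra.{u, v} R) where
  Hom := Hom
  id P := ⟨id, fun a => by rw [FormalSum.map_id]; rfl⟩
  comp g h := ⟨h.toFun ∘ g.toFun, fun a => by
    rw [Function.comp_apply, g.map_act, h.map_act, FormalSum.map_map]⟩

instance (P Q : Contra.{u, v} R) : CoeFun (P ⟶ Q) (fun _ => P → Q) := ⟨Hom.toFun⟩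

variable (P : Contra.{u, v} R)

instance : Zero P := ⟨P.act 0⟩
instance : Add P := ⟨fun p q => P.act (FormalSum.single p + FormalSum.single q)⟩
instance : Neg P := ⟨fun p => P.act (-FormalSum.single p)⟩
instance : Sub P := ⟨fun p q => p + -q⟩
instance : SMul R P := ⟨fun r p => P.act (r • FormalSum.single p)⟩

theorem act_single (p : P) : P.act (FormalSum.single p) = p := P.str.act_single p

theorem act_join (z : FormalSum R (FormalSum R P)) :
    P.act (FormalSum.join z) = P.act (FormalSum.map P.act z) := P.str.act_join z

theorem act_surjective : Function.Surjective P.act := fun p => ⟨_, P.act_single p⟩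

theorem join_single (a : FormalSum R P) : FormalSum.join (FormalSum.single a) = a := by
  rw [FormalSum.join_eq_bind, FormalSum.single_bind]; rfl

theorem join_add (z w : FormalSum R (FormalSum R P)) :
    FormalSum.join (z + w) = FormalSum.join z + FormalSum.join w := FormalSum.bind_add z w id

theorem act_add (a b : FormalSum R P) : P.act (a + b) = P.act a + P.act b := by
  change _ = P.act (FormalSum.single (P.act a) + FormalSum.single (P.act b))
  rw [← FormalSum.map_single P.act a, ← FormalSum.map_single P.act b, ← FormalSum.map_add,
    ← act_join, join_add, join_single, join_single]

theorem act_zero : P.act 0 = 0 := rfl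

theorem act_neg (a : FormalSum R P) : P.act (-a) = -P.act a := by
  change _ = P.act (-FormalSum.single (P.act a))
  rw [← FormalSum.map_single P.act a, ← FormalSum.map_neg, ← act_join]
  congr 1
  have h := P.join_add (-FormalSum.single a) (FormalSum.single a)
  rw [neg_add_cancel, join_single] at h
  have h0 : FormalSum.join (0 : FormalSum R (FormalSum R P)) = 0 := by
    have := P.join_add 0 0
    simpa using this
  rw [h0] at h
  exact (eq_neg_of_add_eq_zero_left h.symm).symm

theorem join_smul_single (r : R) (a : FormalSum R P) :
    FormalSum.join (r • FormalSum.single a) = r • a := by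
  refine Subtype.ext (funext fun x => ?_)
  change ∑' b : FormalSum R P, (r * (FormalSum.single a).1 b) * b.1 x = r * a.1 x
  rw [tsum_eq_single a fun b hb => by simp [FormalSum.single, hb]]
  simp [FormalSum.single]

theorem act_smul (r : R) (a : FormalSum R P) : P.act (r • a) = r • P.act a := by
  change _ = P.act (r • FormalSum.single (P.act a))
  rw [← FormalSum.map_single P.act a, ← FormalSum.map_smul, ← act_join, join_smul_single]

/-- The underlying abelian group of a contramodule: `p + q` is the value of the contraaction
map on the formal linear combination `1 p + 1 q`. -/
instance addCommGroup : AddCommGroup P where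
  add_assoc p q r := by
    obtain ⟨a, rfl⟩ := P.act_surjective p
    obtain ⟨b, rfl⟩ := P.act_surjective q
    obtain ⟨c, rfl⟩ := P.act_surjective r
    simp only [← act_add, add_assoc]
  zero_add p := by
    obtain ⟨a, rfl⟩ := P.act_surjective p
    rw [← act_zero, ← act_add, zero_add]
  add_zero p := by
    obtain ⟨a, rfl⟩ := P.act_surjective p
    rw [← act_zero, ← act_add, add_zero]
  add_comm p q := by
    obtain ⟨a, rfl⟩ := P.act_surjective p
    obtain ⟨b, rfl⟩ := P.act_surjective q
    simp only [← act_add, add_comm]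
  nsmul := nsmulRec
  neg_add_cancel p := by
    obtain ⟨a, rfl⟩ := P.act_surjective p
    rw [← act_neg, ← act_add, neg_add_cancel, act_zero]
  zsmul := zsmulRec

/-- The underlying left `R`-module of a contramodule: `r p` is the value of the contraaction
map on the formal linear combination `r p`. -/
instance module : Module R P where
  one_smul p := by
    obtain ⟨a, rfl⟩ := P.act_surjective p
    rw [← act_smul, one_smul]
  mul_smul r s p := by
    obtain ⟨a, rfl⟩ := P.act_surjective p
    simp only [← act_smul, mul_smul]
  smul_zero r := by rw [← act_zero, ← act_smul, smul_zero]
  smul_add r p q := by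
    obtain ⟨a, rfl⟩ := P.act_surjective p
    obtain ⟨b, rfl⟩ := P.act_surjective q
    simp only [← act_smul, ← act_add, smul_add]
  add_smul r s p := by
    obtain ⟨a, rfl⟩ := P.act_surjective p
    simp only [← act_smul, ← act_add, add_smul]
  zero_smul p := by
    obtain ⟨a, rfl⟩ := P.act_surjective p
    rw [← act_smul, zero_smul, act_zero]

/-- `P.tim A` is the subgroup `A ⋌ P` of `P`, the image of `A[[P]]` under the contraaction map,
for a subgroup `A` of `R`. -/
def tim (A : AddSubgroup R) : AddSubgroup P where
  carrier := {p | ∃ a : FormalSum R P, (∀ x, a.1 x ∈ A) ∧ P.act a = p}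
  zero_mem' := ⟨0, fun _ => A.zero_mem, rfl⟩
  add_mem' := by
    rintro _ _ ⟨a, ha, rfl⟩ ⟨b, hb, rfl⟩
    exact ⟨a + b, fun x => A.add_mem (ha x) (hb x), P.act_add a b⟩
  neg_mem' := by
    rintro _ ⟨a, ha, rfl⟩
    exact ⟨-a, fun x => A.neg_mem (ha x), P.act_neg a⟩

/-- For a left ideal `I` of `R`, the subgroup `I ⋌ P` is an `R`-submodule of `P`. -/
def timSubmodule (I : Ideal R) : Submodule R P where
  __ := P.tim I.toAddSubgroup
  smul_mem' := by
    rintro r _ ⟨a, ha, rfl⟩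
    exact ⟨r • a, fun x => I.mul_mem_left r (ha x), P.act_smul r a⟩

theorem timSubmodule_mono {I I' : Ideal R} (h : I ≤ I') :
    P.timSubmodule I ≤ P.timSubmodule I' := by
  rintro _ ⟨a, ha, rfl⟩
  exact ⟨a, fun x => h (ha x), rfl⟩

theorem smul_mem_tim {I : Ideal R} {r : R} (hr : r ∈ I) (p : P) : r • p ∈ P.timSubmodule I := by
  refine ⟨r • FormalSum.single p, fun x => ?_, rfl⟩
  rw [FormalSum.smul_apply]
  by_cases h : x = p
  · simpa [FormalSum.single, h] using hr
  · simp [FormalSum.single, h]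

/-- The `R/I`-module structure on `P/(I ⋌ P)`, for a two-sided ideal `I` of `R`. -/
instance quotientModule (I : Ideal R) [I.IsTwoSided] :
    Module (R ⧸ I) (P ⧸ P.timSubmodule I) :=
  Module.IsTorsionBySet.module (M := P ⧸ P.timSubmodule I) (I := I) <| by
    rintro x ⟨r, hr⟩
    obtain ⟨p, rfl⟩ := Submodule.Quotient.mk_surjective _ x
    exact (Submodule.Quotient.mk_eq_zero _).2 (P.smul_mem_tim hr p)

/-- A contramodule is separated if the intersection of the subgroups `I ⋌ P` over all the open
right ideals `I` of `R` vanishes, that is, if the map from `P` to `lim P/(I ⋌ P)` is injective. -/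
def IsSeparated : ObjectProperty (Contra.{u, v} R) := fun P =>
  ∀ p : P, (∀ I : Submodule Rᵐᵒᵖ R, IsOpen (I : Set R) → p ∈ P.tim I.toAddSubgroup) → p = 0

/-- Auxiliary: the contramodule structure given by honest infinite sums. -/
def ofSumming {M : Type v} [AddCommGroup M] [Module R M] [UniformSpace M]
    [IsUniformAddGroup M] [CompleteSpace M] [T2Space M] (H : Summing R M) : ContraStr R M where
  act a := ∑' m, a.1 m • m
  act_single m := FormalSum.tsum_single m id
  act_join z := by
    rw [FormalSum.join_eq_bind, FormalSum.map_eq_bind]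
    refine (FormalSum.tsum_bind H z id id).trans
      (Eq.trans ?_ (FormalSum.tsum_bind H z _ id).symm)
    exact tsum_congr fun a => congrArg _ (FormalSum.tsum_single _ id).symm

variable (R) in
/-- The left `R`-contramodule `R`, in which `∑ rₛ s` is evaluated as an infinite sum in the
topology of `R`. -/
def self : Contra.{u, u} R where
  carrier := R
  str := ofSumming (summing_self R)

theorem act_self (a : FormalSum R R) : (self R).act a = ∑' s : R, a.1 s * s := rfl

theorem act_bind {X : Type*} (a : FormalSum R X) (k : X → FormalSum R P) :
    P.act (FormalSum.bind a k) = P.act (FormalSum.map (fun x => P.act (k x)) a) := by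
  rw [← FormalSum.join_map, act_join, FormalSum.map_map]; rfl

/-- The isomorphism `Hom^R(R, P) ≅ P` taking a contramodule morphism `g` to `g(1)`. -/
def evalOne (P : Contra.{u, u} R) : (self R ⟶ P) ≃ P where
  toFun g := Hom.toFun g (1 : R)
  invFun p :=
    { toFun := fun r : R => r • p
      map_act := fun a => by
        refine Eq.trans ?_ (P.act_bind a fun s : R => s • FormalSum.single p)
        change P.act ((∑' s : R, a.1 s * s) • FormalSum.single p) = _
        congr 1
        refine Subtype.ext (funext fun q => ?_)
        change (∑' s : R, a.1 s * s) * (FormalSum.single p).1 q =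
          ∑' s : R, a.1 s * (s * (FormalSum.single p).1 q)
        simp only [← mul_assoc]
        exact (((summing_self R).summable ((summing_self R).tendsto a fun s => s)).map_tsum
          (AddMonoidHom.mulRight ((FormalSum.single p).1 q)) (continuous_mul_const _)) }
  left_inv g := by
    refine Hom.ext (funext fun r : R => ?_)
    have h := Hom.map_act g (r • FormalSum.single (1 : R))
    have h2 : FormalSum.map g.toFun (r • FormalSum.single (1 : R) : FormalSum R R) =
        r • FormalSum.single (Hom.toFun g (1 : R)) :=
      (FormalSum.map_smul (X := R) (Hom.toFun g) r _).trans
        (congrArg _ (FormalSum.map_single (X := R) (Hom.toFun g) (1 : R)))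
    replace h := h.trans (congrArg P.act h2)
    refine Eq.trans h.symm (congrArg (Hom.toFun g) ?_)
    change ∑' s : R, (r * (FormalSum.single (1 : R)).1 s) * s = r
    rw [tsum_eq_single (1 : R) fun s hs => by simp [FormalSum.single, hs]]
    simp [FormalSum.single]
  right_inv p := one_smul R p

variable {M : Type v} [AddCommGroup M] (J : Ideal R) [J.IsTwoSided] [Module (R ⧸ J) M]

theorem finite_support_act (hJ : IsOpen (J : Set R)) (a : FormalSum R M) :
    (Function.support fun m => Ideal.Quotient.mk J (a.1 m) • m).Finite := by
  refine (show {m | a.1 m ∉ J}.Finite from a.2 (hJ.mem_nhds J.zero_mem)).subset ?_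
  intro m hm hmJ
  exact hm (by simp only [Ideal.Quotient.eq_zero_iff_mem.2 hmJ, zero_smul])

variable (M) in
/-- A left module over the discrete quotient ring `R/J`, where `J` is an open two-sided ideal,
viewed as a left `R`-contramodule. The sum in the definition of the contraaction map has only
finitely many nonzero terms. -/
def ofModule (hJ : IsOpen (J : Set R)) : Contra.{u, v} R where
  carrier := M
  str :=
    letI act : FormalSum R M → M := fun a => ∑ᶠ m, Ideal.Quotient.mk J (a.1 m) • m
    letI : Module R M := Module.compHom M (Ideal.Quotient.mk J)
    letI : UniformSpace M := ⊥
    haveI : DiscreteUniformity M := ⟨rfl⟩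
    have H : Summing R M :=
      { nonarch := ⟨fun U hU => ⟨⟨⊥, isOpen_discrete _⟩, by
          rintro _ rfl
          exact mem_of_mem_nhds hU⟩⟩
        unif := fun U hU => ⟨J, hJ.mem_nhds J.zero_mem, fun r hr m => by
          have : r • m = 0 := by
            change Ideal.Quotient.mk J r • m = 0
            rw [Ideal.Quotient.eq_zero_iff_mem.2 hr, zero_smul]
          rw [this]
          exact mem_of_mem_nhds hU⟩
        cont := fun r => continuous_of_discreteTopology }
    have h : act = (ofSumming H).act :=
      funext fun a => (tsum_eq_finsum (finite_support_act J hJ a)).symm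
    { act := act
      act_single := by rw [h]; exact (ofSumming H).act_single
      act_join := by rw [h]; exact (ofSumming H).act_join }

end Contra

/-- The category of separated left `R`-contramodules, a full subcategory of the category of left
`R`-contramodules. -/
abbrev SepContra := (Contra.IsSeparated (R := R) : ObjectProperty (Contra.{u, v} R)).FullSubcategory

end Contra

/-! ### Restriction of scalars, strong right tautness -/

section Change

variable {R S : Type u}
  [Ring R] [UniformSpace R] [IsUniformAddGroup R] [IsTopologicalRing R]
  [Ring S] [UniformSpace S] [IsUniformAddGroup S] [IsTopologicalRing S]

/-- The map `f[[X]] : R[[X]] → S[[X]]`, taking `∑ aₓ x` to `∑ f(aₓ) x`. -/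
def FormalSum.mapCoeff {X : Type*} (f : R →+* S) (hf : Continuous f) (a : FormalSum R X) :
    FormalSum S X :=
  ⟨fun x => f (a.1 x), by
    have := (hf.tendsto 0).comp a.2
    rwa [_root_.map_zero f] at this⟩

/-- A ring map between two-sided linear topological rings is strongly right taut if the open
two-sided ideals `I` of `R` for which the closure of the right ideal `f(I)S` of `S` is an open
two-sided ideal of `S` form a base of neighbourhoods of zero in `R`. -/
def StronglyRightTaut (f : R →+* S) : Prop :=
  ∀ U ∈ 𝓝 (0 : R), ∃ I : Ideal R, I.IsTwoSided ∧ IsOpen (I : Set R) ∧ (I : Set R) ⊆ U ∧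
    ∃ J : Ideal S, J.IsTwoSided ∧ IsOpen (J : Set S) ∧
      (J : Set S) = closure (Submodule.span Sᵐᵒᵖ (f '' (I : Set R)) : Set S)

/-- Descending chains of open two-sided ideals `I₀ ⊇ I₁ ⊇ ⋯` of `R` and `J₀ ⊇ J₁ ⊇ ⋯` of `S`,
forming bases of neighbourhoods of zero, such that `Jₙ` is the closure of the right ideal
`f(Iₙ)S`. -/
structure TautChain (f : R →+* S) where
  I : ℕ → Ideal R
  J : ℕ → Ideal S
  twoSided_I : ∀ n, (I n).IsTwoSided
  twoSided_J : ∀ n, (J n).IsTwoSided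
  isOpen_I : ∀ n, IsOpen (I n : Set R)
  isOpen_J : ∀ n, IsOpen (J n : Set S)
  basis_I : (𝓝 (0 : R)).HasAntitoneBasis fun n => (I n : Set R)
  basis_J : (𝓝 (0 : S)).HasAntitoneBasis fun n => (J n : Set S)
  closure_eq : ∀ n, (J n : Set S) = closure (Submodule.span Sᵐᵒᵖ (f '' (I n : Set R)) : Set S)

attribute [instance] TautChain.twoSided_I TautChain.twoSided_J

namespace TautChain

variable {f : R →+* S} (T : TautChain f)

theorem I_le (n : ℕ) : T.I (n + 1) ≤ T.I n := T.basis_I.antitone n.le_succ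

theorem J_le (n : ℕ) : T.J (n + 1) ≤ T.J n := T.basis_J.antitone n.le_succ

theorem I_le_comap (n : ℕ) : T.I n ≤ (T.J n).comap f := fun r hr => by
  change f r ∈ (T.J n : Set S)
  rw [T.closure_eq n]
  exact subset_closure (Submodule.subset_span ⟨r, hr, rfl⟩)

/-- The ring map `Rₙ → Sₙ` induced by `f`, where `Rₙ = R/Iₙ` and `Sₙ = S/Jₙ`. -/
def quotientMap (n : ℕ) : R ⧸ T.I n →+* S ⧸ T.J n := Ideal.quotientMap (T.J n) f (T.I_le_comap n)

end TautChain

variable [IsLinearTopology Rᵐᵒᵖ R] [CompleteSpace R] [T2Space R]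
  [IsLinearTopology Sᵐᵒᵖ S] [CompleteSpace S] [T2Space S]
  (f : R →+* S) (hf : Continuous f)

namespace FormalSum

variable {X Y : Type*}

theorem mapCoeff_single (x : X) : mapCoeff f hf (single x) = single x := by
  refine Subtype.ext (funext fun y => ?_)
  by_cases h : y = x <;> simp [mapCoeff, single, h]

theorem mapCoeff_bind (a : FormalSum R X) (k : X → FormalSum R Y) :
    mapCoeff f hf (bind a k) = bind (mapCoeff f hf a) fun x => mapCoeff f hf (k x) := by
  refine Subtype.ext (funext fun y => ?_)
  have := ((summing_self R).summable
    ((summing_self R).tendsto a fun x => (k x).1 y)).map_tsum f hf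
  simp only [smul_eq_mul, map_mul f] at this
  exact this

theorem mapCoeff_map (g : X → Y) (a : FormalSum R X) :
    mapCoeff f hf (map g a) = map g (mapCoeff f hf a) := by
  simp only [map_eq_bind, mapCoeff_bind, mapCoeff_single]

theorem mapCoeff_join (z : FormalSum R (FormalSum R X)) :
    mapCoeff f hf (join z) = join (map (mapCoeff f hf) (mapCoeff f hf z)) := by
  rw [join_map, join_eq_bind]
  exact mapCoeff_bind f hf z id

end FormalSum

namespace Contra

/-- The functor of restriction of scalars from left `S`-contramodules to left `R`-contramodules:
the set remains the same, and the contraaction is composed with `f[[Q]] : R[[Q]] → S[[Q]]`. -/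
def restrictScalars : Contra.{u, v} S ⥤ Contra.{u, v} R where
  obj Q :=
    { carrier := Q
      str :=
        { act := fun a => Q.act (FormalSum.mapCoeff f hf a)
          act_single := fun q => by rw [FormalSum.mapCoeff_single, act_single]
          act_join := fun z => by
            rw [FormalSum.mapCoeff_join, act_join, FormalSum.map_map]
            exact congrArg Q.act (FormalSum.mapCoeff_map f hf _ z).symm } }
  map g := ⟨g.toFun, fun a => by
    refine (g.map_act _).trans ?_
    rw [← FormalSum.mapCoeff_map]
    rfl⟩

theorem restrictScalars_separated {Q : Contra.{u, v} S} (hQ : IsSeparated Q) :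
    IsSeparated ((restrictScalars f hf).obj Q) := by
  intro q hq
  have h0 : (0 : (restrictScalars f hf).obj Q) = (0 : Q) := by
    change Q.act (FormalSum.mapCoeff f hf 0) = Q.act 0
    congr 1
    exact Subtype.ext (funext fun x => map_zero f)
  rw [h0]
  refine hQ q fun J hJ => ?_
  let I : Submodule Rᵐᵒᵖ R :=
    { carrier := f ⁻¹' (J : Set S)
      zero_mem' := by simp
      add_mem' := fun {a b} ha hb => by
        rw [Set.mem_preimage, map_add f]
        exact J.add_mem ha hb
      smul_mem' := fun c x hx => by
        rw [Set.mem_preimage, ← op_unop c, op_smul_eq_mul, map_mul f]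
        exact J.smul_mem (op (f c.unop)) hx }
  obtain ⟨a, ha, rfl⟩ := hq I (hJ.preimage hf)
  exact ⟨FormalSum.mapCoeff f hf a, ha, rfl⟩

end Contra

/-- The functor of restriction of scalars from separated left `S`-contramodules to separated left
`R`-contramodules. -/
def SepContra.restrictScalars : SepContra.{u, v} S ⥤ SepContra.{u, v} R :=
  ObjectProperty.lift _ (ObjectProperty.ι _ ⋙ Contra.restrictScalars f hf)
    fun Q => Contra.restrictScalars_separated f hf Q.property

/-- The ring map `f : R → S` as a morphism of left `R`-contramodules. -/
def Contra.selfMap : Contra.self R ⟶ (Contra.restrictScalars f hf).obj (Contra.self S) where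
  toFun := f
  map_act (a : FormalSum R R) := by
    change f (∑' s : R, a.1 s * s) =
      ∑' t : S, (FormalSum.mapCoeff f hf (FormalSum.map (Y := S) f a)).1 t * t
    rw [FormalSum.mapCoeff_map, FormalSum.map_eq_bind]
    refine Eq.trans ?_ (FormalSum.tsum_bind (summing_self S) (FormalSum.mapCoeff f hf a)
      (fun s : R => FormalSum.single (f s)) id).symm
    have h := ((summing_self R).summable
      ((summing_self R).tendsto a fun s => s)).map_tsum f hf
    simp only [smul_eq_mul, map_mul f] at h
    exact h.trans (tsum_congr fun s => congrArg _ (FormalSum.tsum_single (f s) id).symm)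

/-- The set `Hom^R(S, P)` of left `R`-contramodule morphisms from `S` to `P`. -/
abbrev HomFrom (P : Contra.{u, u} R) : Type u :=
  (Contra.restrictScalars f hf).obj (Contra.self S) ⟶ P

/-- The value at `s ∈ S` of an element of `Hom^R(S, P)`. -/
def HomFrom.eval {f : R →+* S} {hf : Continuous f} {P : Contra.{u, u} R}
    (h : HomFrom f hf P) (s : S) : P := Contra.Hom.toFun h s

/-- A choice of separated left `S`-contramodule structures on the sets `Hom^R(S, P)`, for all
separated left `R`-contramodules `P`, such that for every morphism `P → P'` the composition map
`Hom^R(S, P) → Hom^R(S, P')` is a morphism of `S`-contramodules. -/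
structure CoextensionStructure where
  str : ∀ P : SepContra.{u, u} R, ContraStr S (HomFrom f hf P.obj)
  separated : ∀ P, Contra.IsSeparated (⟨_, str P⟩ : Contra.{u, u} S)
  natural : ∀ {P P' : SepContra.{u, u} R} (g : P ⟶ P') (a : FormalSum S (HomFrom f hf P.obj)),
    (str P).act a ≫ g.hom = (str P').act (FormalSum.map (fun h => h ≫ g.hom) a)

namespace CoextensionStructure

variable {f hf}

/-- The functor `P ↦ Hom^R(S, P)` from separated left `R`-contramodules to separated left
`S`-contramodules defined by a choice of contramodule structures. -/
def functor (C : CoextensionStructure f hf) : SepContra.{u, u} R ⥤ SepContra.{u, u} S where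
  obj P := ⟨⟨HomFrom f hf P.obj, C.str P⟩, C.separated P⟩
  map g := ⟨⟨fun h => h ≫ g.hom, C.natural g⟩⟩

end CoextensionStructure

/-- The left `Sₙ`-module `Hom_{Rₙ}(Sₙ, Pₙ)`, where `Pₙ = P/(Iₙ ⋌ P)`. -/
abbrev TautChain.homModule {f : R →+* S} (T : TautChain f) (P : Contra.{u, u} R) (n : ℕ) :
    ModuleCat.{u} (S ⧸ T.J n) :=
  (ModuleCat.coextendScalars (T.quotientMap n)).obj
    (ModuleCat.of (R ⧸ T.I n) (P ⧸ P.timSubmodule (T.I n)))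

/-- The value at `x ∈ Sₙ` of an element of `Hom_{Rₙ}(Sₙ, Pₙ)`. -/
def TautChain.homModule.eval {f : R →+* S} {T : TautChain f} {P : Contra.{u, u} R} {n : ℕ}
    (g : T.homModule P n) (x : S ⧸ T.J n) : P ⧸ P.timSubmodule (T.I n) :=
  ModuleCat.CoextendScalars.equiv _ _ g x

/-- The left `Sₙ`-module `Hom_{Rₙ}(Sₙ, Pₙ)`, viewed as a left `S`-contramodule. -/
abbrev TautChain.homContra {f : R →+* S} (T : TautChain f) (P : Contra.{u, u} R) (n : ℕ) :
    Contra.{u, u} S :=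
  Contra.ofModule (T.homModule P n) (T.J n) (T.isOpen_J n)

/-- The transition map of the projective system `(Hom_{Rₙ}(Sₙ, Pₙ))ₙ` takes `g'` to `g`: the
maps `g' : Sₙ₊₁ → Pₙ₊₁` and `g : Sₙ → Pₙ` form a commutative square with the natural surjections
`Sₙ₊₁ → Sₙ` and `Pₙ₊₁ → Pₙ`. -/
def TautChain.Compatible {f : R →+* S} (T : TautChain f) (P : Contra.{u, u} R) (n : ℕ)
    (g' : T.homModule P (n + 1)) (g : T.homModule P n) : Prop :=
  ∀ x : S ⧸ T.J (n + 1), Submodule.factor (P.timSubmodule_mono (T.I_le n)) (homModule.eval g' x) =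
    homModule.eval g (Ideal.Quotient.factor (T.J_le n) x)

end Change

end Contramodules

end

/-!
Modulo an open ideal a contraaction becomes a finite sum, so an `R`-linear map between separated
contramodules is a contramodule morphism as soon as it respects the subgroups `Iₙ ⋌ -`. Tautness
enters through the equality `Iₙ ⋌ Q = Jₙ ⋌ Q` for separated left `S`-contramodules `Q`: since
`f(Iₙ)S` is dense in `Jₙ`, every element of `Jₙ ⋌ Q` lies in `Iₙ ⋌ Q + Jₙ₊₁ ⋌ Q`, and successive
approximation removes the error term. For `Q = S` it shows that contramodule morphisms `S → P` are
the compatible families of `Rₙ`-linear maps `Sₙ → Pₙ`. As the image of `Hom^R(S, P)` in the product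
of the `Sₙ`-modules `Hom_{Rₙ}(Sₙ, Pₙ)` is closed under contraactions, it inherits a contramodule
structure, characterised by `(∑ sₕ h)(t) ≡ ∑ h(t sₕ)` modulo every `Iₙ ⋌ P` (a finite sum). The unit
of the adjunction is `q ↦ (s ↦ s q)`, and the counit is evaluation at `1`.
-/

noncomputable section

namespace Contramodules

/-! ### Successive approximation -/

section SeriesConverge

variable {G H : Type*} [AddCommGroup G] [AddCommGroup H]

/-- Completeness of an abelian group along a sequence of subgroups, in the form needed for
successive approximation: every series whose `n`-th term lies in `F n` has a sum `b`, possibly not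
unique, whose `n`-th remainder lies in `F n`. -/
def SeriesConverge (F : ℕ → AddSubgroup G) : Prop :=
  ∀ a : ℕ → G, (∀ n, a n ∈ F n) → ∃ b, ∀ n, b - ∑ k ∈ Finset.range n, a k ∈ F n

namespace SeriesConverge

variable {F : ℕ → AddSubgroup G}

theorem map (hF : SeriesConverge F) (φ : G →+ H) : SeriesConverge fun n => (F n).map φ := by
  intro a ha
  choose a' ha' hφa' using ha
  obtain ⟨b, hb⟩ := hF a' ha'
  refine ⟨φ b, fun n => ⟨_, hb n, ?_⟩⟩
  rw [map_sub, map_sum, Finset.sum_congr rfl fun k _ => hφa' k]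

theorem exists_limit (hF : SeriesConverge F) {p : ℕ → G} (hp : ∀ n, p (n + 1) - p n ∈ F n) :
    ∃ q, ∀ n, q - p n ∈ F n := by
  obtain ⟨b, hb⟩ := hF _ hp
  refine ⟨b + p 0, fun n => ?_⟩
  have hbn := hb n
  rwa [Finset.sum_range_sub, sub_sub_eq_add_sub] at hbn

theorem le_map (hF : SeriesConverge F) (φ : G →+ H) {E : ℕ → AddSubgroup H}
    (hFE : ∀ n, F n ≤ (E n).comap φ) (hE : ∀ n, E n ≤ (F n).map φ ⊔ E (n + 1))
    (hE_bot : ∀ x, (∀ n, x ∈ E n) → x = 0) : E 0 ≤ (F 0).map φ := by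
  intro x hx
  have hstep (n : ℕ) (y : E n) : ∃ a ∈ F n, y.1 - φ a ∈ E (n + 1) := by
    obtain ⟨_, ⟨a, ha, rfl⟩, z, hz, hyz⟩ := AddSubgroup.mem_sup.1 (hE n y.2)
    exact ⟨a, ha, by rwa [← hyz, add_sub_cancel_left]⟩
  choose a ha hrem using hstep
  let y (n : ℕ) : E n := Nat.rec ⟨x, hx⟩ (fun n y => ⟨y - φ (a n y), hrem n y⟩) n
  have hy (n : ℕ) : x = φ (∑ k ∈ Finset.range n, a k (y k)) + (y n).1 := by
    induction n with
    | zero =>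
      rw [Finset.range_zero, Finset.sum_empty, map_zero, zero_add]
      rfl
    | succ n ih =>
      rw [Finset.sum_range_succ, map_add, add_assoc]
      exact ih.trans (congrArg _ (add_sub_cancel _ _).symm)
  obtain ⟨b, hb⟩ := hF (fun n => a n (y n)) fun n => ha n (y n)
  have hb0 : b ∈ F 0 := by simpa only [Finset.range_zero, Finset.sum_empty, sub_zero] using hb 0
  refine ⟨b, hb0, sub_eq_zero.1 (hE_bot _ fun n => ?_)⟩
  have hbx : φ b - x = φ (b - ∑ k ∈ Finset.range n, a k (y k)) - (y n).1 := by
    conv_lhs => rw [hy n]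
    rw [map_sub, sub_sub]
  rw [hbx]
  exact sub_mem (hFE n (hb n)) (y n).2

end SeriesConverge

end SeriesConverge

/-! ### Formal sums with coefficients in a subgroup -/

namespace FormalSum

section Group

variable {A : Type u} [AddCommGroup A] [TopologicalSpace A] [IsTopologicalAddGroup A]
  {X : Type v} {G : Type*} {B : AddSubgroup A}

/-- The subgroup `B[[X]]` of `A[[X]]`, for a subgroup `B` of `A`. -/
def coeffsIn (B : AddSubgroup A) : AddSubgroup (FormalSum A X) where
  carrier := {a | ∀ x, a.1 x ∈ B}
  zero_mem' _ := B.zero_mem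
  add_mem' ha hb x := B.add_mem (ha x) (hb x)
  neg_mem' ha x := B.neg_mem (ha x)

theorem finite_support_of_isOpen [Zero G] (hB : IsOpen (B : Set A)) (a : FormalSum A X) {F : X → G}
    (hF : ∀ x, a.1 x ∈ B → F x = 0) : (Function.support F).Finite :=
  Set.Finite.subset (a.2 (hB.mem_nhds B.zero_mem)) fun x hx hxB => hx (hF x hxB)

end Group

section Complete

variable {A : Type u} [AddCommGroup A] [UniformSpace A] [IsUniformAddGroup A] [CompleteSpace A]
  [T2Space A] {X : Type v}

theorem seriesConverge_coeffsIn {B : ℕ → AddSubgroup A}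
    (hB : (𝓝 (0 : A)).HasAntitoneBasis fun n => (B n : Set A)) :
    SeriesConverge fun n => coeffsIn (X := X) (B n) := by
  intro a ha
  have hopen (n : ℕ) : IsOpen (B n : Set A) :=
    AddSubgroup.isOpen_of_mem_nhds _ (hB.toHasBasis.mem_of_mem trivial)
  have : NonarchimedeanAddGroup A := ⟨fun U hU => by
    obtain ⟨n, hn⟩ := hB.mem_iff.1 hU
    exact ⟨⟨B n, hopen n⟩, hn⟩⟩
  have hsum (x : X) : Summable fun n => (a n).1 x := by
    refine NonarchimedeanAddGroup.summable_of_tendsto_cofinite_zero ?_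
    rw [Nat.cofinite_eq_atTop]
    exact hB.tendsto fun n => ha n x
  have hrem (n : ℕ) (x : X) : (∑' k, (a k).1 x) - (∑ k ∈ Finset.range n, (a k).1 x) ∈ B n := by
    rw [← (hsum x).sum_add_tsum_nat_add n, add_sub_cancel_left]
    exact tsum_mem (AddSubgroup.isClosed_of_isOpen _ (hopen n)) fun k =>
      hB.antitone (Nat.le_add_left n k) (ha (k + n) x)
  have hb : Tendsto (fun x => ∑' k, (a k).1 x) cofinite (𝓝 0) := by
    rw [hB.toHasBasis.tendsto_right_iff]
    intro n _
    filter_upwards [(∑ k ∈ Finset.range n, a k).2 (hB.toHasBasis.mem_of_mem trivial)] with x hx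
    rw [Set.mem_preimage, AddSubgroup.val_finsetSum, Finset.sum_apply] at hx
    simpa only [sub_add_cancel, SetLike.mem_coe] using (B n).add_mem (hrem n x) hx
  refine ⟨⟨_, hb⟩, fun n x => ?_⟩
  rw [AddSubgroup.coe_sub, AddSubgroup.val_finsetSum, Pi.sub_apply, Finset.sum_apply]
  exact hrem n x

end Complete

section Ring

variable {R : Type u} [Ring R] [UniformSpace R] [IsUniformAddGroup R] [IsTopologicalRing R]
  [IsLinearTopology Rᵐᵒᵖ R] {X Y G : Type*} [AddCommGroup G]

open Classical in
theorem smul_single_apply (r : R) (x y : X) :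
    (r • single (R := R) x).1 y = if y = x then r else 0 := by
  change r * (if y = x then 1 else 0) = _
  rw [mul_ite, mul_one, mul_zero]

theorem smul_single_mem_coeffsIn {A : AddSubgroup R} {r : R} (hr : r ∈ A) (x : X) :
    r • single (R := R) x ∈ coeffsIn A := fun y => by
  rw [smul_single_apply]
  split_ifs
  exacts [hr, A.zero_mem]

theorem sub_sum_mem_coeffsIn {A : AddSubgroup R} {a : FormalSum R X} {s : Finset X}
    (hs : ∀ x ∉ s, a.1 x ∈ A) : a - ∑ x ∈ s, a.1 x • single x ∈ coeffsIn A := by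
  classical
  have hsum (y : X) :
      (∑ x ∈ s, a.1 x • single (R := R) x).1 y = if y ∈ s then a.1 y else 0 := by
    simp only [AddSubgroup.val_finsetSum, Finset.sum_apply, smul_single_apply, Finset.sum_ite_eq]
  intro y
  rw [AddSubgroup.coe_sub, Pi.sub_apply, hsum]
  by_cases hy : y ∈ s
  · simp [hy]
  · simpa [hy] using hs y hy

theorem map_eq_finsum_of_isOpen {A : AddSubgroup R} (hA : IsOpen (A : Set R))
    (φ : FormalSum R X →+ G) (hφ : ∀ a ∈ coeffsIn A, φ a = 0) (a : FormalSum R X) :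
    φ a = ∑ᶠ x, φ (a.1 x • single x) := by
  have hfin : {x | a.1 x ∉ A}.Finite := a.2 (hA.mem_nhds A.zero_mem)
  have hrem := sub_sum_mem_coeffsIn (A := A) (a := a) (s := hfin.toFinset) fun x hx => by
    simpa using hx
  have hsupport : Function.support (fun x => φ (a.1 x • single x)) ⊆ hfin.toFinset := by
    intro x hx
    by_contra hxA
    exact hx (hφ _ (smul_single_mem_coeffsIn (by simpa using hxA) x))
  rw [finsum_eq_sum_of_support_subset _ hsupport, ← map_sum, ← sub_eq_zero, ← map_sub]
  exact hφ _ hrem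

theorem map_mem_coeffsIn [CompleteSpace R] [T2Space R] {A : AddSubgroup R}
    (hA : IsClosed (A : Set R)) (k : X → Y)
    {a : FormalSum R X} (ha : a ∈ coeffsIn A) : map k a ∈ coeffsIn A :=
  fun _ => tsum_mem hA fun x => ha x.1

end Ring

end FormalSum

/-! ### Contramodules modulo open ideals -/

section ContraModuloIdeals

variable {R : Type u} [Ring R] [UniformSpace R] [IsUniformAddGroup R] [IsTopologicalRing R]
  [IsLinearTopology Rᵐᵒᵖ R] [CompleteSpace R] [T2Space R]

namespace Contra

section Tim

variable (P : Contra.{u, v} R)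

/-- The contraaction map as a homomorphism of abelian groups. -/
def actHom : FormalSum R P →+ P := AddMonoidHom.mk' P.act P.act_add

theorem seriesConverge_tim {A : ℕ → AddSubgroup R}
    (hA : (𝓝 (0 : R)).HasAntitoneBasis fun n => (A n : Set R)) :
    SeriesConverge fun n => P.tim (A n) :=
  (FormalSum.seriesConverge_coeffsIn hA).map P.actHom

variable {P}

theorem act_map_smul_single {X : Type*} (k : X → P) (r : R) (x : X) :
    P.act (FormalSum.map k (r • FormalSum.single x)) = r • k x := by
  rw [FormalSum.map_smul, FormalSum.map_single, act_smul, act_single]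

theorem tim_le_of_smul_mem {A B : AddSubgroup R} (hA : IsOpen (A : Set R)) {E : AddSubgroup P}
    (hAE : P.tim A ≤ E) (hBE : ∀ r ∈ B, ∀ p : P, r • p ∈ E) : P.tim B ≤ E := by
  rintro _ ⟨a, ha, rfl⟩
  rw [← QuotientAddGroup.eq_zero_iff]
  refine (FormalSum.map_eq_finsum_of_isOpen hA ((QuotientAddGroup.mk' E).comp P.actHom)
    (fun b hb => (QuotientAddGroup.eq_zero_iff _).2 (hAE ⟨b, hb, rfl⟩)) a).trans ?_
  refine finsum_eq_zero_of_forall_eq_zero fun p => (QuotientAddGroup.eq_zero_iff _).2 ?_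
  have hterm : P.actHom (a.1 p • FormalSum.single p) = a.1 p • p :=
    (P.act_smul _ _).trans (congrArg _ (P.act_single p))
  exact hterm ▸ hBE _ (ha p) p

theorem smul_mem_of_mem_closure_span {A : Set R} {J : Ideal R} (hJ : IsOpen (J : Set R))
    {E : AddSubgroup P} (hJE : P.tim J.toAddSubgroup ≤ E) (hAE : ∀ s ∈ A, ∀ p : P, s • p ∈ E)
    {s : R} (hs : s ∈ closure (Submodule.span Rᵐᵒᵖ A : Set R)) (p : P) : s • p ∈ E := by
  have hspan (t : R) (ht : t ∈ Submodule.span Rᵐᵒᵖ A) : ∀ p : P, t • p ∈ E := by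
    induction ht using Submodule.span_induction with
    | mem t ht => exact hAE t ht
    | zero => exact fun p => (zero_smul R p).symm ▸ E.zero_mem
    | add t t' _ _ iht iht' => exact fun p => (add_smul t t' p).symm ▸ E.add_mem (iht p) (iht' p)
    | smul c t _ iht => exact fun p => (mul_smul t c.unop p).symm ▸ iht (c.unop • p)
  have hnhds : {t | s - t ∈ J} ∈ 𝓝 s :=
    (hJ.preimage (continuous_const.sub continuous_id)).mem_nhds (by simp)
  obtain ⟨t, hst, ht⟩ := mem_closure_iff_nhds.1 hs _ hnhds
  rw [← sub_add_cancel s t, add_smul]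
  exact E.add_mem (hJE (P.smul_mem_tim hst p)) (hspan t ht p)

theorem mk_smul_eq_zero {J : Ideal R} {r : R} (hr : r ∈ J) (p : P) :
    (Submodule.Quotient.mk (r • p) : P ⧸ P.timSubmodule J) = 0 :=
  (Submodule.Quotient.mk_eq_zero _).2 (P.smul_mem_tim hr p)

theorem mk_act_map {X : Type*} {J : Ideal R} (hJ : IsOpen (J : Set R)) (k : X → P)
    (a : FormalSum R X) : (Submodule.Quotient.mk (P.act (FormalSum.map k a)) :
      P ⧸ P.timSubmodule J) = ∑ᶠ x, Submodule.Quotient.mk (a.1 x • k x) := by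
  let φ : FormalSum R X →+ P ⧸ P.timSubmodule J :=
    AddMonoidHom.mk' (fun a => Submodule.Quotient.mk (P.act (FormalSum.map k a))) fun a b => by
      rw [FormalSum.map_add, act_add, Submodule.Quotient.mk_add]
  have hφ (b : FormalSum R X) (hb : b ∈ FormalSum.coeffsIn J.toAddSubgroup) : φ b = 0 :=
    (Submodule.Quotient.mk_eq_zero _).2 ⟨_, FormalSum.map_mem_coeffsIn
      (AddSubgroup.isClosed_of_isOpen J.toAddSubgroup hJ) k hb, rfl⟩
  refine (FormalSum.map_eq_finsum_of_isOpen (A := J.toAddSubgroup) hJ φ hφ a).trans ?_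
  exact finsum_congr fun x => congrArg _ (act_map_smul_single k _ x)

end Tim

theorem IsSeparated.eq_of_forall_mk_eq {P : Contra.{u, v} R} (hP : IsSeparated P) {ι : Type*}
    {I : ι → Ideal R} (hI : (𝓝 (0 : R)).HasBasis (fun _ => True) fun i => (I i : Set R)) {p q : P}
    (h : ∀ i, (Submodule.Quotient.mk p : P ⧸ P.timSubmodule (I i)) = Submodule.Quotient.mk q) :
    p = q := by
  refine sub_eq_zero.1 (hP _ fun N hN => ?_)
  obtain ⟨i, -, hi⟩ := hI.mem_iff.1 (hN.mem_nhds N.zero_mem)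
  obtain ⟨a, ha, hpq⟩ := (Submodule.Quotient.eq _).1 (h i)
  exact ⟨a, fun x => hi (ha x), hpq⟩

theorem IsSeparated.eq_zero {P : Contra.{u, v} R} (hP : IsSeparated P) {ι : Type*}
    {I : ι → Ideal R} (hI : (𝓝 (0 : R)).HasBasis (fun _ => True) fun i => (I i : Set R)) {p : P}
    (h : ∀ i, p ∈ P.timSubmodule (I i)) : p = 0 :=
  hP.eq_of_forall_mk_eq hI fun i => (Submodule.Quotient.mk_eq_zero _).2 (h i)

theorem isSeparated_of_twoSided {P : Contra.{u, v} R} {ι : Type*} {I : ι → Ideal R}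
    [∀ i, (I i).IsTwoSided] (hI : ∀ i, IsOpen (I i : Set R))
    (h : ∀ p : P, (∀ i, p ∈ P.timSubmodule (I i)) → p = 0) : IsSeparated P := by
  refine fun p hp => h p fun i => ?_
  exact hp
    { (I i).toAddSubmonoid with smul_mem' := fun s _ hr => (I i).mul_mem_right s.unop hr } (hI i)

namespace Hom

variable {P Q : Contra.{u, v} R} (g : P ⟶ Q)

protected theorem map_add (p q : P) : g (p + q) = g p + g q := by
  refine (g.map_act _).trans ?_
  rw [FormalSum.map_add, FormalSum.map_single, FormalSum.map_single]
  rfl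

protected theorem map_smul (r : R) (p : P) : g (r • p) = r • g p := by
  refine (g.map_act _).trans ?_
  rw [FormalSum.map_smul, FormalSum.map_single]
  rfl

/-- The map of underlying left modules of a morphism of contramodules. -/
def toLinearMap : P →ₗ[R] Q where
  toFun := g
  map_add' := Hom.map_add g
  map_smul' := Hom.map_smul g

theorem timSubmodule_le_comap {I : Ideal R} (hI : IsClosed (I : Set R)) :
    P.timSubmodule I ≤ (Q.timSubmodule I).comap (toLinearMap g) := by
  rintro _ ⟨a, ha, rfl⟩
  exact ⟨_, FormalSum.map_mem_coeffsIn (A := I.toAddSubgroup) hI g ha, (Hom.map_act g a).symm⟩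

variable {ι : Type*} {I : ι → Ideal R}

/-- An `R`-linear map to a separated contramodule is a morphism of contramodules as soon as it
respects the subgroups `I ⋌ P` for a base of open left ideals `I`. -/
def ofLinearMap (hQ : IsSeparated Q)
    (hI : (𝓝 (0 : R)).HasBasis (fun _ => True) fun i => (I i : Set R)) (g : P →ₗ[R] Q)
    (hg : ∀ i, P.timSubmodule (I i) ≤ (Q.timSubmodule (I i)).comap g) : P ⟶ Q where
  toFun := g
  map_act a := by
    refine hQ.eq_of_forall_mk_eq hI fun i => ?_
    have hopen : IsOpen (I i : Set R) :=
      AddSubgroup.isOpen_of_mem_nhds (I i).toAddSubgroup (hI.mem_of_mem trivial)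
    have hfin : (Function.support fun p : P =>
        (Submodule.Quotient.mk (a.1 p • p) : P ⧸ P.timSubmodule (I i))).Finite :=
      FormalSum.finite_support_of_isOpen (B := (I i).toAddSubgroup) hopen a fun p hp =>
        mk_smul_eq_zero hp p
    rw [mk_act_map hopen, ← Submodule.mapQ_apply _ _ _ (h := hg i)]
    conv_lhs => rw [← FormalSum.map_id a, mk_act_map hopen]
    refine (AddMonoidHom.map_finsum (Submodule.mapQ _ _ g (hg i)).toAddMonoidHom hfin).trans ?_
    exact finsum_congr fun p => congrArg Submodule.Quotient.mk (g.map_smul _ _)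

end Hom

/-! ### Free modules of rank one and modules over discrete quotients -/

section OfSumming

variable {M : Type v} [AddCommGroup M] [Module R M] [UniformSpace M] [IsUniformAddGroup M]
  [CompleteSpace M] [T2Space M] (H : Summing R M)

theorem ofSumming_act_add (a b : FormalSum R M) :
    (ofSumming H).act (a + b) = (ofSumming H).act a + (ofSumming H).act b := by
  refine Eq.trans ?_ ((H.summable (H.tendsto a id)).tsum_add (H.summable (H.tendsto b id)))
  exact tsum_congr fun m => add_smul (a.1 m) (b.1 m) m

theorem ofSumming_act_smul_single (r : R) (m : M) :
    (ofSumming H).act (r • FormalSum.single m) = r • m := by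
  refine (tsum_eq_single m fun x hx => ?_).trans ?_
  · rw [FormalSum.smul_single_apply, if_neg hx, zero_smul]
  · rw [FormalSum.smul_single_apply, if_pos rfl]

end OfSumming

variable (R) in
/-- The underlying left module of the contramodule `R` is the free module `R`. -/
def selfEquiv : R ≃ₗ[R] self R where
  __ := Equiv.refl R
  map_add' r s := ((ofSumming_act_add (summing_self R) _ _).trans
    (congrArg₂ (· + ·) ((self R).act_single r) ((self R).act_single s))).symm
  map_smul' r s := (ofSumming_act_smul_single (summing_self R) r s).symm

theorem act_self_mem {A : AddSubgroup R} (hA : IsClosed (A : Set R))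
    (hmul : ∀ r ∈ A, ∀ s, r * s ∈ A) {a : FormalSum R R} (ha : a ∈ FormalSum.coeffsIn A) :
    (self R).act a ∈ (A : Set R) :=
  tsum_mem hA fun s => hmul _ (ha s) s

theorem selfEquiv_mem_timSubmodule_iff {J : Ideal R} [J.IsTwoSided] (hJ : IsClosed (J : Set R))
    {s : R} : selfEquiv R s ∈ (self R).timSubmodule J ↔ s ∈ J := by
  refine ⟨fun ⟨a, ha, has⟩ => ?_, fun hs => ?_⟩
  · have hmem := act_self_mem (A := J.toAddSubgroup) hJ (fun r hr s => J.mul_mem_right s hr) ha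
    rwa [has] at hmem
  · rw [← mul_one s, ← smul_eq_mul, map_smul]
    exact smul_mem_tim _ hs _

theorem isSeparated_self : IsSeparated (self R) := by
  intro (p : R) hp
  have hp_mem (N : Submodule Rᵐᵒᵖ R) (hN : IsOpen (N : Set R)) : p ∈ N := by
    obtain ⟨a, ha, rfl⟩ := hp N hN
    exact act_self_mem (AddSubgroup.isClosed_of_isOpen N.toAddSubgroup hN)
      (fun r hr s => N.smul_mem (op s) hr) ha
  have hp0 : p = 0 := by
    by_contra hne
    obtain ⟨N, hN, hNp⟩ := (IsLinearTopology.hasBasis_open_submodule Rᵐᵒᵖ).mem_iff.1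
      (isOpen_compl_singleton.mem_nhds (Ne.symm hne))
    exact hNp (hp_mem N hN) rfl
  exact (congrArg (selfEquiv R) hp0).trans (map_zero (selfEquiv R))

section OfModule

variable {M : Type v} [AddCommGroup M] {J : Ideal R} [J.IsTwoSided] [Module (R ⧸ J) M]
  (hJ : IsOpen (J : Set R))

theorem ofModule_act_map {X : Type*} (k : X → M) (a : FormalSum R X) :
    (ofModule M J hJ).act (FormalSum.map k a) = ∑ᶠ x, Ideal.Quotient.mk J (a.1 x) • k x := by
  let φ : FormalSum R X →+ M :=
    AddMonoidHom.mk' (fun a => ∑ᶠ m, Ideal.Quotient.mk J ((FormalSum.map k a).1 m) • m)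
      fun a b => by
        refine Eq.trans (finsum_congr fun m => ?_)
          (finsum_add_distrib (finite_support_act J hJ _) (finite_support_act J hJ _))
        rw [FormalSum.map_add, ← add_smul, ← map_add]
        rfl
  have hφ (b : FormalSum R X) (hb : b ∈ FormalSum.coeffsIn J.toAddSubgroup) : φ b = 0 := by
    have hmap := FormalSum.map_mem_coeffsIn
      (AddSubgroup.isClosed_of_isOpen J.toAddSubgroup hJ) k hb
    exact finsum_eq_zero_of_forall_eq_zero fun m => by
      rw [Ideal.Quotient.eq_zero_iff_mem.2 (hmap m), zero_smul]
  have hφ_single (r : R) (x : X) : φ (r • FormalSum.single x) = Ideal.Quotient.mk J r • k x := by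
    change ∑ᶠ m, Ideal.Quotient.mk J ((FormalSum.map k (r • FormalSum.single x)).1 m) • m = _
    rw [FormalSum.map_smul, FormalSum.map_single, finsum_eq_single _ (k x) fun m hm => by
      rw [FormalSum.smul_single_apply, if_neg hm, map_zero, zero_smul]]
    rw [FormalSum.smul_single_apply, if_pos rfl]
  refine (FormalSum.map_eq_finsum_of_isOpen (A := J.toAddSubgroup) hJ φ hφ a).trans ?_
  exact finsum_congr fun x => hφ_single _ x

end OfModule

end Contra

namespace ContraStr

/-- A family of jointly injective maps to contramodules whose image is closed under the
contraactions induces a contramodule structure on the source. -/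
def ofJointlyInjective {M : Type*} {ι : Type*} {N : ι → Contra.{u, v} R} (ρ : ∀ i, M → N i)
    (hρ : ∀ m m', (∀ i, ρ i m = ρ i m') → m = m')
    (hact : ∀ a : FormalSum R M, ∃ m, ∀ i, ρ i m = (N i).act (FormalSum.map (ρ i) a)) :
    ContraStr R M where
  act a := (hact a).choose
  act_single m := hρ _ _ fun i => by
    rw [(hact _).choose_spec i, FormalSum.map_single, Contra.act_single]
  act_join z := hρ _ _ fun i => by
    have hcomp : (ρ i ∘ fun a => (hact a).choose) = fun a => (N i).act (FormalSum.map (ρ i) a) :=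
      funext fun a => (hact a).choose_spec i
    rw [(hact _).choose_spec i, (hact _).choose_spec i, FormalSum.map_map, hcomp,
      ← Contra.act_bind, FormalSum.join_eq_bind, FormalSum.map_eq_bind (ρ i), FormalSum.bind_bind]
    simp only [id, ← FormalSum.map_eq_bind]

theorem ofJointlyInjective_act {M : Type*} {ι : Type*} {N : ι → Contra.{u, v} R}
    {ρ : ∀ i, M → N i} (hρ : ∀ m m', (∀ i, ρ i m = ρ i m') → m = m')
    (hact : ∀ a : FormalSum R M, ∃ m, ∀ i, ρ i m = (N i).act (FormalSum.map (ρ i) a))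
    (a : FormalSum R M) (i : ι) :
    ρ i ((ofJointlyInjective ρ hρ hact).act a) = (N i).act (FormalSum.map (ρ i) a) :=
  (hact a).choose_spec i

end ContraStr

end ContraModuloIdeals

/-! ### Taut chains -/

section Chains

variable {R S : Type u} [Ring R] [UniformSpace R] [Ring S] [UniformSpace S] {f : R →+* S}

theorem hasBasis_closure_span [IsTopologicalRing S] [IsLinearTopology Sᵐᵒᵖ S] (hf : Continuous f)
    {ι : Type*} {I : ι → Ideal R}
    (hI : (𝓝 (0 : R)).HasBasis (fun _ => True) fun i => (I i : Set R)) {J : ι → Ideal S}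
    (hJ_open : ∀ i, IsOpen (J i : Set S))
    (hJ : ∀ i, (J i : Set S) = closure (Submodule.span Sᵐᵒᵖ (f '' (I i : Set R)) : Set S)) :
    (𝓝 (0 : S)).HasBasis (fun _ => True) fun i => (J i : Set S) := by
  refine ⟨fun U => ⟨fun hU => ?_, fun ⟨i, _, hi⟩ => ?_⟩⟩
  · obtain ⟨N, hN, hNU⟩ := (IsLinearTopology.hasBasis_open_submodule Sᵐᵒᵖ).mem_iff.1 hU
    have hfN : f ⁻¹' N ∈ 𝓝 (0 : R) :=
      (hN.preimage hf).mem_nhds (by rw [Set.mem_preimage, map_zero]; exact N.zero_mem)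
    obtain ⟨i, -, hi⟩ := hI.mem_iff.1 hfN
    have hspan : Submodule.span Sᵐᵒᵖ (f '' (I i : Set R)) ≤ N :=
      Submodule.span_le.2 (Set.image_subset_iff.2 hi)
    have hN_closed : IsClosed (N : Set S) := AddSubgroup.isClosed_of_isOpen N.toAddSubgroup hN
    refine ⟨i, trivial, Set.Subset.trans ?_ hNU⟩
    rw [hJ i]
    exact closure_minimal hspan hN_closed
  · exact mem_of_superset ((hJ_open i).mem_nhds (J i).zero_mem) hi

theorem StronglyRightTaut.nonempty_tautChain [IsTopologicalRing S] [IsLinearTopology Sᵐᵒᵖ S]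
    [(𝓝 (0 : R)).IsCountablyGenerated] (hf : Continuous f) (hft : StronglyRightTaut f) :
    Nonempty (TautChain f) := by
  have hbasis : (𝓝 (0 : R)).HasBasis
      (fun I : Ideal R => I.IsTwoSided ∧ IsOpen (I : Set R) ∧
        ∃ J : Ideal S, J.IsTwoSided ∧ IsOpen (J : Set S) ∧
          (J : Set S) = closure (Submodule.span Sᵐᵒᵖ (f '' (I : Set R)) : Set S))
      fun I => (I : Set R) := by
    refine ⟨fun U => ⟨fun hU => ?_, fun ⟨I, ⟨_, hI, _⟩, hIU⟩ => ?_⟩⟩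
    · obtain ⟨I, hI_twoSided, hI, hIU, hJ⟩ := hft U hU
      exact ⟨I, ⟨hI_twoSided, hI, hJ⟩, hIU⟩
    · exact mem_of_superset (hI.mem_nhds I.zero_mem) hIU
  obtain ⟨I, hI, hI_basis⟩ := hbasis.exists_antitone_subbasis
  choose hI_twoSided hI_open J hJ_twoSided hJ_open hJ_eq using hI
  have hJ_antitone : Antitone fun n => (J n : Set S) := fun m n hmn => by
    simp only [hJ_eq]
    exact closure_mono (Submodule.span_mono (Set.image_mono (hI_basis.antitone hmn)))
  exact ⟨⟨I, J, hI_twoSided, hJ_twoSided, hI_open, hJ_open, hI_basis,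
    ⟨hasBasis_closure_span hf hI_basis.toHasBasis hJ_open hJ_eq, hJ_antitone⟩, hJ_eq⟩⟩

namespace TautChain

theorem isClosed_J [IsTopologicalRing S] (T : TautChain f) (n : ℕ) : IsClosed (T.J n : Set S) :=
  AddSubgroup.isClosed_of_isOpen (T.J n).toAddSubgroup (T.isOpen_J n)

theorem isClosed_I [IsTopologicalRing R] (T : TautChain f) (n : ℕ) : IsClosed (T.I n : Set R) :=
  AddSubgroup.isClosed_of_isOpen (T.I n).toAddSubgroup (T.isOpen_I n)

end TautChain

end Chains

/-! ### Restriction of scalars along a strongly right taut map -/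

section Restriction

variable {R S : Type u}
  [Ring R] [UniformSpace R] [IsTopologicalRing R] [Ring S] [UniformSpace S] [IsTopologicalRing S]
  {f : R →+* S} (hf : Continuous f)

namespace FormalSum

variable {X : Type*}

theorem mapCoeff_add (a b : FormalSum R X) :
    mapCoeff f hf (a + b) = mapCoeff f hf a + mapCoeff f hf b :=
  Subtype.ext (funext fun _ => _root_.map_add f _ _)

variable [IsUniformAddGroup R] [IsLinearTopology Rᵐᵒᵖ R]
  [IsUniformAddGroup S] [IsLinearTopology Sᵐᵒᵖ S]

theorem mapCoeff_smul (r : R) (a : FormalSum R X) :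
    mapCoeff f hf (r • a) = f r • mapCoeff f hf a :=
  Subtype.ext (funext fun _ => map_mul f _ _)

end FormalSum

variable [IsUniformAddGroup R] [IsLinearTopology Rᵐᵒᵖ R] [CompleteSpace R] [T2Space R]
  [IsUniformAddGroup S] [IsLinearTopology Sᵐᵒᵖ S] [CompleteSpace S] [T2Space S]

namespace Contra

/-- Restriction of scalars does not change the underlying abelian group. -/
def restrictEquiv (Q : Contra.{u, v} S) : Q ≃+ (restrictScalars f hf).obj Q where
  __ := Equiv.refl Q.carrier
  map_add' p q := by
    refine ((congrArg Q.act (FormalSum.mapCoeff_add hf (FormalSum.single (R := R) p)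
      (FormalSum.single q))).trans ?_).symm
    rw [FormalSum.mapCoeff_single, FormalSum.mapCoeff_single]
    rfl

variable (Q : Contra.{u, v} S)

theorem restrictEquiv_smul (r : R) (q : Q) :
    restrictEquiv hf Q (f r • q) = r • restrictEquiv hf Q q := by
  refine ((congrArg Q.act (FormalSum.mapCoeff_smul hf r (FormalSum.single q))).trans ?_).symm
  rw [FormalSum.mapCoeff_single]
  rfl

end Contra

namespace TautChain

variable (T : TautChain f) {Q : Contra.{u, v} S}

theorem tim_I_le_tim_J (n : ℕ) : ((Contra.restrictScalars f hf).obj Q).tim (T.I n).toAddSubgroup ≤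
    (Q.tim (T.J n).toAddSubgroup).comap (Contra.restrictEquiv hf Q).symm.toAddMonoidHom := by
  rintro _ ⟨a, ha, rfl⟩
  exact ⟨FormalSum.mapCoeff f hf a, fun x => T.I_le_comap n (ha x), rfl⟩

theorem tim_J_le_sup (n : ℕ) : Q.tim (T.J n).toAddSubgroup ≤
    (((Contra.restrictScalars f hf).obj Q).tim (T.I n).toAddSubgroup).map
      (Contra.restrictEquiv hf Q).symm.toAddMonoidHom ⊔ Q.tim (T.J (n + 1)).toAddSubgroup := by
  refine Contra.tim_le_of_smul_mem (A := (T.J (n + 1)).toAddSubgroup) (T.isOpen_J _) le_sup_right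
    fun s hs q => ?_
  refine Contra.smul_mem_of_mem_closure_span (T.isOpen_J (n + 1)) le_sup_right ?_
    ((T.closure_eq n).subset hs) q
  rintro _ ⟨r, hr, rfl⟩ q
  refine AddSubgroup.mem_sup_left ⟨r • Contra.restrictEquiv hf Q q, Contra.smul_mem_tim _ hr _, ?_⟩
  rw [← Contra.restrictEquiv_smul]
  exact (Contra.restrictEquiv hf Q).symm_apply_apply _

theorem restrictEquiv_mem_timSubmodule_iff (hQ : Contra.IsSeparated Q) {n : ℕ} {q : Q} :
    Contra.restrictEquiv hf Q q ∈ ((Contra.restrictScalars f hf).obj Q).timSubmodule (T.I n) ↔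
      q ∈ Q.timSubmodule (T.J n) := by
  refine ⟨fun hq => T.tim_I_le_tim_J hf n hq, fun hq => ?_⟩
  have hshift : StrictMono fun k => n + k := fun _ _ hkl => Nat.add_lt_add_left hkl n
  have hI := T.basis_I.comp_strictMono hshift
  have hJ := T.basis_J.comp_strictMono hshift
  have hle := (Contra.seriesConverge_tim (A := fun k => (T.I (n + k)).toAddSubgroup)
    ((Contra.restrictScalars f hf).obj Q) hI).le_map (Contra.restrictEquiv hf Q).symm.toAddMonoidHom
    (fun k => T.tim_I_le_tim_J hf (n + k)) (fun k => T.tim_J_le_sup hf (n + k))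
    fun x hx => hQ.eq_zero (I := fun k => T.J (n + k)) hJ.toHasBasis hx
  obtain ⟨p, hp, rfl⟩ := hle hq
  exact ((Contra.restrictEquiv hf Q).apply_symm_apply p).symm ▸ hp

end TautChain

end Restriction

/-! ### Morphisms from `S` and their reductions -/

section HomModule

variable {R S : Type u}
  [Ring R] [UniformSpace R] [IsUniformAddGroup R] [IsTopologicalRing R]
  [IsLinearTopology Rᵐᵒᵖ R] [CompleteSpace R] [T2Space R]
  [Ring S] [UniformSpace S] [IsUniformAddGroup S] [IsTopologicalRing S]
  {f : R →+* S} {P : Contra.{u, u} R}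

namespace TautChain

variable {T : TautChain f} {n : ℕ}

namespace homModule

theorem ext_eval {g h : T.homModule P n}
    (H : ∀ s, eval g (Ideal.Quotient.mk _ s) = eval h (Ideal.Quotient.mk _ s)) : g = h :=
  ModuleCat.CoextendScalars.ext (LinearMap.ext fun x => by
    obtain ⟨s, rfl⟩ := Ideal.Quotient.mk_surjective x
    exact H s)

theorem eval_add (g : T.homModule P n) (x y : S ⧸ T.J n) :
    eval g (x + y) = eval g x + eval g y :=
  map_add (ModuleCat.CoextendScalars.equiv _ _ g) x y

theorem eval_zero (g : T.homModule P n) : eval g 0 = 0 :=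
  map_zero (ModuleCat.CoextendScalars.equiv _ _ g)

theorem eval_quotientMap_mul (g : T.homModule P n) (r : R ⧸ T.I n) (x : S ⧸ T.J n) :
    eval g (T.quotientMap n r * x) = r • eval g x :=
  (ModuleCat.CoextendScalars.equiv _ _ g).map_smul r x

/-- Evaluation at a point of `Sₙ` as a homomorphism of abelian groups. -/
def evalHom (x : S ⧸ T.J n) : T.homModule P n →+ P ⧸ P.timSubmodule (T.I n) where
  toFun g := eval g x
  map_zero' := rfl
  map_add' _ _ := rfl

/-- The `Rₙ`-linear map `Sₙ → Pₙ` induced by an `R`-linear map `S → Pₙ` vanishing on `Jₙ`. -/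
def lift (φ : S →+ P ⧸ P.timSubmodule (T.I n)) (hφ : ∀ r s, φ (f r * s) = r • φ s)
    (hφ_zero : ∀ s ∈ T.J n, φ s = 0) : T.homModule P n :=
  (ModuleCat.CoextendScalars.equiv _ _).symm
    { QuotientAddGroup.lift (T.J n).toAddSubgroup φ hφ_zero with
      map_smul' := fun r x => by
        obtain ⟨r, rfl⟩ := Ideal.Quotient.mk_surjective r
        obtain ⟨s, rfl⟩ := Ideal.Quotient.mk_surjective x
        exact hφ r s }

theorem eval_lift (φ : S →+ P ⧸ P.timSubmodule (T.I n)) (hφ : ∀ r s, φ (f r * s) = r • φ s)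
    (hφ_zero : ∀ s ∈ T.J n, φ s = 0) (s : S) :
    eval (lift φ hφ hφ_zero) (Ideal.Quotient.mk _ s) = φ s := rfl

end homModule

theorem exists_forall_mk_eq_eval (g : ∀ n, T.homModule P n)
    (hg : ∀ n, T.Compatible P n (g (n + 1)) (g n)) (s : S) :
    ∃ p : P, ∀ n, (Submodule.Quotient.mk p : P ⧸ P.timSubmodule (T.I n)) =
      homModule.eval (g n) (Ideal.Quotient.mk _ s) := by
  choose p hp using fun n =>
    Submodule.Quotient.mk_surjective _ (homModule.eval (g n) (Ideal.Quotient.mk _ s))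
  have hstep (n : ℕ) : p (n + 1) - p n ∈ P.timSubmodule (T.I n) := by
    rw [← Submodule.Quotient.eq, hp n]
    refine Eq.trans ?_ (hg n (Ideal.Quotient.mk _ s))
    rw [← hp (n + 1)]
    rfl
  obtain ⟨q, hq⟩ := (P.seriesConverge_tim (A := fun n => (T.I n).toAddSubgroup)
    T.basis_I).exists_limit hstep
  exact ⟨q, fun n => ((Submodule.Quotient.eq _).2 (hq n)).trans (hp n)⟩

end TautChain

end HomModule

section Coextension

variable {R S : Type u}
  [Ring R] [UniformSpace R] [IsUniformAddGroup R] [IsTopologicalRing R]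
  [IsLinearTopology Rᵐᵒᵖ R] [CompleteSpace R] [T2Space R]
  [Ring S] [UniformSpace S] [IsUniformAddGroup S] [IsTopologicalRing S]
  [IsLinearTopology Sᵐᵒᵖ S] [CompleteSpace S] [T2Space S]
  {f : R →+* S} {hf : Continuous f} {P : Contra.{u, u} R}

variable (hf) in
/-- The underlying abelian group of the left `R`-contramodule `S` is that of the ring `S`. -/
def Contra.restrictSelfEquiv : S ≃+ (restrictScalars f hf).obj (self S) :=
  (selfEquiv S).toAddEquiv.trans (restrictEquiv hf (self S))

theorem Contra.restrictSelfEquiv_map_mul (r : R) (s : S) :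
    restrictSelfEquiv hf (f r * s) = r • restrictSelfEquiv hf s :=
  (congrArg (restrictEquiv hf (self S)) ((selfEquiv S).map_smul (f r) s)).trans
    (restrictEquiv_smul hf (self S) r _)

theorem TautChain.restrictSelfEquiv_mem_timSubmodule_iff (T : TautChain f) {n : ℕ} {s : S} :
    Contra.restrictSelfEquiv hf s ∈
      ((Contra.restrictScalars f hf).obj (Contra.self S)).timSubmodule (T.I n) ↔ s ∈ T.J n :=
  (T.restrictEquiv_mem_timSubmodule_iff hf Contra.isSeparated_self).trans
    (Contra.selfEquiv_mem_timSubmodule_iff (T.isClosed_J n))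

namespace HomFrom

theorem ext_eval {g h : HomFrom f hf P} (H : ∀ s, g.eval s = h.eval s) : g = h :=
  Contra.Hom.ext (funext H)

theorem eval_add (h : HomFrom f hf P) (s t : S) : h.eval (s + t) = h.eval s + h.eval t :=
  (congrArg (Contra.Hom.toFun h) (map_add (Contra.restrictSelfEquiv hf) s t)).trans
    (Contra.Hom.map_add h _ _)

theorem eval_map_mul (h : HomFrom f hf P) (r : R) (s : S) : h.eval (f r * s) = r • h.eval s :=
  (congrArg (Contra.Hom.toFun h) (Contra.restrictSelfEquiv_map_mul r s)).trans
    (Contra.Hom.map_smul h r _)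

theorem eval_mem (T : TautChain f) (h : HomFrom f hf P) {n : ℕ} {s : S} (hs : s ∈ T.J n) :
    h.eval s ∈ P.timSubmodule (T.I n) :=
  Contra.Hom.timSubmodule_le_comap h (T.isClosed_I n)
    (T.restrictSelfEquiv_mem_timSubmodule_iff.2 hs)

/-- The contramodule morphism `S → P` given by an `R`-linear map that takes `Jₙ` to `Iₙ ⋌ P`. -/
def ofAddMonoidHom (T : TautChain f) (hP : Contra.IsSeparated P) (φ : S →+ P)
    (hφ : ∀ r s, φ (f r * s) = r • φ s)
    (hφ_mem : ∀ n, ∀ s ∈ T.J n, φ s ∈ P.timSubmodule (T.I n)) : HomFrom f hf P :=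
  Contra.Hom.ofLinearMap hP T.basis_I.toHasBasis
    { φ.comp (Contra.restrictSelfEquiv hf).symm.toAddMonoidHom with
      map_smul' := fun r s => by
        obtain ⟨s, rfl⟩ := (Contra.restrictSelfEquiv hf).surjective s
        rw [← Contra.restrictSelfEquiv_map_mul]
        exact hφ r s }
    fun n s hs => by
      obtain ⟨s, rfl⟩ := (Contra.restrictSelfEquiv hf).surjective s
      exact hφ_mem n s (T.restrictSelfEquiv_mem_timSubmodule_iff.1 hs)

theorem eval_ofAddMonoidHom (T : TautChain f) (hP : Contra.IsSeparated P) (φ : S →+ P)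
    (hφ : ∀ r s, φ (f r * s) = r • φ s)
    (hφ_mem : ∀ n, ∀ s ∈ T.J n, φ s ∈ P.timSubmodule (T.I n)) (s : S) :
    (ofAddMonoidHom (hf := hf) T hP φ hφ hφ_mem).eval s = φ s := rfl

end HomFrom

namespace TautChain

variable {T : TautChain f} {n : ℕ}

variable (T n) in
/-- The map `Hom^R(S, P) → Hom_{Rₙ}(Sₙ, Pₙ)` induced by passage to the quotients. -/
def reduce (h : HomFrom f hf P) : T.homModule P n :=
  homModule.lift
    ((Submodule.mkQ _).toAddMonoidHom.comp (AddMonoidHom.mk' h.eval h.eval_add))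
    (fun r s => congrArg Submodule.Quotient.mk (h.eval_map_mul r s))
    fun _ hs => (Submodule.Quotient.mk_eq_zero _).2 (h.eval_mem T hs)

theorem eval_reduce (h : HomFrom f hf P) (s : S) :
    homModule.eval (T.reduce n h) (Ideal.Quotient.mk _ s) = Submodule.Quotient.mk (h.eval s) :=
  homModule.eval_lift _ _ _ s

variable (T) in
theorem eq_of_forall_reduce_eq (hP : Contra.IsSeparated P) {g h : HomFrom f hf P}
    (H : ∀ n, T.reduce n g = T.reduce n h) : g = h :=
  HomFrom.ext_eval fun s => hP.eq_of_forall_mk_eq T.basis_I.toHasBasis fun n =>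
    congrArg (homModule.eval · (Ideal.Quotient.mk _ s)) (H n)

theorem exists_forall_reduce_eq (hP : Contra.IsSeparated P) (g : ∀ n, T.homModule P n)
    (hg : ∀ n, T.Compatible P n (g (n + 1)) (g n)) :
    ∃ h : HomFrom f hf P, ∀ n, T.reduce n h = g n := by
  choose φ hφ using exists_forall_mk_eq_eval g hg
  have hφ_add (s t : S) : φ (s + t) = φ s + φ t :=
    hP.eq_of_forall_mk_eq T.basis_I.toHasBasis fun n => by
      rw [hφ, map_add, homModule.eval_add, ← hφ, ← hφ, Submodule.Quotient.mk_add]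
  have hφ_mul (r : R) (s : S) : φ (f r * s) = r • φ s :=
    hP.eq_of_forall_mk_eq T.basis_I.toHasBasis fun n => by
      rw [hφ, map_mul]
      refine (homModule.eval_quotientMap_mul (g n) (Ideal.Quotient.mk _ r) _).trans ?_
      rw [← hφ]
      rfl
  have hφ_mem (n : ℕ) (s : S) (hs : s ∈ T.J n) : φ s ∈ P.timSubmodule (T.I n) := by
    rw [← Submodule.Quotient.mk_eq_zero, hφ, Ideal.Quotient.eq_zero_iff_mem.2 hs,
      homModule.eval_zero]
  refine ⟨.ofAddMonoidHom T hP (AddMonoidHom.mk' φ hφ_add) hφ_mul hφ_mem, fun n => ?_⟩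
  refine homModule.ext_eval fun s => (eval_reduce _ s).trans ?_
  exact (congrArg _ (HomFrom.eval_ofAddMonoidHom T hP _ hφ_mul hφ_mem s)).trans (hφ s n)

theorem existsUnique_reduce_eq (hP : Contra.IsSeparated P) (g : ∀ n, T.homModule P n)
    (hg : ∀ n, T.Compatible P n (g (n + 1)) (g n)) :
    ∃! h : HomFrom f hf P, ∀ n, T.reduce n h = g n := by
  obtain ⟨h, hh⟩ := exists_forall_reduce_eq (hf := hf) hP g hg
  exact ⟨h, hh, fun h' hh' => T.eq_of_forall_reduce_eq hP fun n => (hh' n).trans (hh n).symm⟩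

section Sums

variable {X : Type*} (k : X → HomFrom f hf P) (a : FormalSum S X)

variable (T) in
theorem finite_support_mk_eval_mul (n : ℕ) (t : S) : (Function.support fun x =>
    (Submodule.Quotient.mk ((k x).eval (t * a.1 x)) : P ⧸ P.timSubmodule (T.I n))).Finite :=
  FormalSum.finite_support_of_isOpen (B := (T.J n).toAddSubgroup) (T.isOpen_J n) a fun x hx =>
    (Submodule.Quotient.mk_eq_zero _).2 ((k x).eval_mem T ((T.J n).mul_mem_left t hx))

theorem factor_finsum_mk_eval_mul {m : ℕ} {I : Ideal R} (hI : T.I m ≤ I) (t : S) :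
    Submodule.factor (P.timSubmodule_mono hI)
        (∑ᶠ x, Submodule.Quotient.mk ((k x).eval (t * a.1 x))) =
      ∑ᶠ x, Submodule.Quotient.mk ((k x).eval (t * a.1 x)) :=
  AddMonoidHom.map_finsum (Submodule.factor (P.timSubmodule_mono hI)).toAddMonoidHom
    (T.finite_support_mk_eval_mul k a m t)

theorem eval_homContra_act_map (t : S) :
    homModule.eval ((T.homContra P n).act (FormalSum.map (fun x => T.reduce n (k x)) a))
      (Ideal.Quotient.mk _ t) = ∑ᶠ x, Submodule.Quotient.mk ((k x).eval (t * a.1 x)) := by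
  have hfin : (Function.support fun x =>
      Ideal.Quotient.mk (T.J n) (a.1 x) • T.reduce n (k x)).Finite :=
    FormalSum.finite_support_of_isOpen (B := (T.J n).toAddSubgroup) (T.isOpen_J n) a
      fun x hx => by rw [Ideal.Quotient.eq_zero_iff_mem.2 hx, zero_smul]
  refine (congrArg (homModule.eval · (Ideal.Quotient.mk _ t))
    (Contra.ofModule_act_map (T.isOpen_J n) (fun x => T.reduce n (k x)) a)).trans ?_
  exact AddMonoidHom.map_finsum (homModule.evalHom (Ideal.Quotient.mk (T.J n) t)) hfin

end Sums

end TautChain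

/-! ### The contramodule structure on the morphisms from `S` -/

namespace HomFrom

theorem exists_forall_reduce_eq_act (T : TautChain f) (hP : Contra.IsSeparated P)
    (a : FormalSum S (HomFrom f hf P)) : ∃ h : HomFrom f hf P, ∀ n,
      T.reduce n h = (T.homContra P n).act (FormalSum.map (T.reduce n) a) := by
  refine TautChain.exists_forall_reduce_eq hP _ fun n x => ?_
  obtain ⟨t, rfl⟩ := Ideal.Quotient.mk_surjective x
  refine (congrArg _ (TautChain.eval_homContra_act_map id a t)).trans ?_
  refine (TautChain.factor_finsum_mk_eval_mul id a (T.I_le n) t).trans ?_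
  exact (TautChain.eval_homContra_act_map id a t).symm

/-- The contramodule structure on `Hom^R(S, P)` for which, modulo every `Iₙ ⋌ P`, the infinite
sums are given by `(∑ sₕ h)(t) = ∑ h(t sₕ)`. It is obtained from a taut chain, but does not depend
on it. -/
def contraStr (T : TautChain f) (hP : Contra.IsSeparated P) : ContraStr S (HomFrom f hf P) :=
  .ofJointlyInjective (N := T.homContra P) T.reduce (fun _ _ => T.eq_of_forall_reduce_eq hP)
    (exists_forall_reduce_eq_act T hP)

variable (hf) in
/-- The left `S`-contramodule `Hom^R(S, P)`. -/
def contra (T : TautChain f) (hP : Contra.IsSeparated P) : Contra.{u, u} S where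
  carrier := HomFrom f hf P
  str := contraStr T hP

section Act

variable (T₀ : TautChain f) (hP : Contra.IsSeparated P) (T : TautChain f) (n : ℕ)

theorem mk_eval_act_map {X : Type*} (k : X → HomFrom f hf P) (a : FormalSum S X) (t : S) :
    (Submodule.Quotient.mk (eval ((contraStr T₀ hP).act (FormalSum.map k a)) t) :
      P ⧸ P.timSubmodule (T.I n)) = ∑ᶠ x, Submodule.Quotient.mk ((k x).eval (t * a.1 x)) := by
  obtain ⟨m, -, hm⟩ := T₀.basis_I.toHasBasis.mem_iff.1 (T.basis_I.toHasBasis.mem_of_mem trivial)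
  have hreduce : T₀.reduce m ((contraStr T₀ hP).act (FormalSum.map k a)) =
      (T₀.homContra P m).act (FormalSum.map (fun x => T₀.reduce m (k x)) a) := by
    refine (ContraStr.ofJointlyInjective_act (N := T₀.homContra P)
      (fun _ _ => T₀.eq_of_forall_reduce_eq hP) (exists_forall_reduce_eq_act T₀ hP) _ m).trans ?_
    exact congrArg (T₀.homContra P m).act (FormalSum.map_map (T₀.reduce m) k a)
  have hmk := congrArg (TautChain.homModule.eval · (Ideal.Quotient.mk _ t)) hreduce
  refine (congrArg (Submodule.factor (P.timSubmodule_mono hm))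
    (hmk.trans (TautChain.eval_homContra_act_map k a t))).trans ?_
  exact TautChain.factor_finsum_mk_eval_mul k a hm t

theorem mk_eval_act (a : FormalSum S (HomFrom f hf P)) (t : S) :
    (Submodule.Quotient.mk (eval ((contraStr T₀ hP).act a) t) : P ⧸ P.timSubmodule (T.I n)) =
      ∑ᶠ h : HomFrom f hf P, Submodule.Quotient.mk (h.eval (t * a.1 h)) := by
  conv_lhs => rw [← FormalSum.map_id a]
  exact mk_eval_act_map T₀ hP T n id a t

/-- The morphism of left `S`-contramodules `Hom^R(S, P) → Hom_{Rₙ}(Sₙ, Pₙ)`. -/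
def reduceHom : contra hf T₀ hP ⟶ T.homContra P n where
  toFun := T.reduce n
  map_act a := TautChain.homModule.ext_eval fun t =>
    (mk_eval_act T₀ hP T n a t).trans (TautChain.eval_homContra_act_map id a t).symm

end Act

section UnderlyingModule

variable (T : TautChain f) (hP : Contra.IsSeparated P)

theorem eval_act_add (a b : FormalSum S (HomFrom f hf P)) (t : S) :
    eval ((contraStr T hP).act (a + b)) t =
      eval ((contraStr T hP).act a) t + eval ((contraStr T hP).act b) t := by
  refine hP.eq_of_forall_mk_eq T.basis_I.toHasBasis fun n => ?_
  rw [Submodule.Quotient.mk_add]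
  simp only [mk_eval_act]
  refine Eq.trans (finsum_congr fun h => ?_) (finsum_add_distrib
    (T.finite_support_mk_eval_mul id a n t) (T.finite_support_mk_eval_mul id b n t))
  rw [AddSubgroup.coe_add, Pi.add_apply, mul_add, eval_add, Submodule.Quotient.mk_add]

theorem eval_act_smul (s : S) (a : FormalSum S (HomFrom f hf P)) (t : S) :
    eval ((contraStr T hP).act (s • a)) t = eval ((contraStr T hP).act a) (t * s) := by
  refine hP.eq_of_forall_mk_eq T.basis_I.toHasBasis fun n => ?_
  simp only [mk_eval_act, FormalSum.smul_apply, mul_assoc]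

theorem eval_add_apply (g h : contra hf T hP) (t : S) :
    eval (hf := hf) (P := P) (g + h) t =
      eval (hf := hf) (P := P) g t + eval (hf := hf) (P := P) h t :=
  (eval_act_add T hP (FormalSum.single g) (FormalSum.single h) t).trans <|
    congrArg₂ (fun g h : HomFrom f hf P => g.eval t + h.eval t)
      ((contraStr T hP).act_single g) ((contraStr T hP).act_single h)

theorem eval_smul_apply (s : S) (h : contra hf T hP) (t : S) :
    eval (hf := hf) (P := P) (s • h) t = eval (hf := hf) (P := P) h (t * s) :=
  (eval_act_smul T hP s (FormalSum.single h) t).trans <|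
    congrArg (fun h : HomFrom f hf P => h.eval (t * s)) ((contraStr T hP).act_single h)

theorem isSeparated_contra : Contra.IsSeparated (contra hf T hP) := by
  have hzero (t : S) : eval (hf := hf) (P := P) (0 : contra hf T hP) t = 0 :=
    map_zero (AddMonoidHom.mk' (fun h : contra hf T hP => eval (hf := hf) (P := P) h t)
      fun g h => eval_add_apply T hP g h t)
  refine Contra.isSeparated_of_twoSided T.isOpen_J fun h hh => ext_eval fun t => ?_
  rw [hzero]
  refine hP.eq_zero T.basis_I.toHasBasis fun n => ?_
  obtain ⟨a, ha, rfl⟩ := hh n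
  rw [← Submodule.Quotient.mk_eq_zero]
  refine (mk_eval_act T hP T n a t).trans (finsum_eq_zero_of_forall_eq_zero fun k => ?_)
  exact (Submodule.Quotient.mk_eq_zero _).2 (k.eval_mem T ((T.J n).mul_mem_left t (ha k)))

end UnderlyingModule

theorem act_comp (T : TautChain f) {P' : Contra.{u, u} R} (hP : Contra.IsSeparated P)
    (hP' : Contra.IsSeparated P') (g : P ⟶ P') (a : FormalSum S (HomFrom f hf P)) :
    (contraStr T hP).act a ≫ g =
      (contraStr T hP').act (FormalSum.map (fun h => h ≫ g) a) := by
  refine ext_eval fun t => hP'.eq_of_forall_mk_eq T.basis_I.toHasBasis fun n => ?_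
  let g_mod : P ⧸ P.timSubmodule (T.I n) →+ P' ⧸ P'.timSubmodule (T.I n) :=
    (Submodule.mapQ _ _ (Contra.Hom.toLinearMap g)
      (Contra.Hom.timSubmodule_le_comap g (T.isClosed_I n))).toAddMonoidHom
  refine (congrArg g_mod (mk_eval_act T hP T n a t)).trans ?_
  refine (g_mod.map_finsum (T.finite_support_mk_eval_mul id a n t)).trans ?_
  exact (mk_eval_act_map T hP' T n (fun h => h ≫ g) a t).symm

end HomFrom

/-! ### The adjunction -/

namespace TautChain

variable (hf) in
/-- The contramodule structures on the sets `Hom^R(S, P)` obtained from a taut chain. -/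
def coextension (T : TautChain f) : CoextensionStructure f hf where
  str P := HomFrom.contraStr T P.property
  separated P := HomFrom.isSeparated_contra T P.property
  natural {P P'} g a := HomFrom.act_comp T P.property P'.property g.hom a

variable (T : TautChain f)

/-- The morphism `Q → Hom^R(S, Q)` taking `q` to the map `s ↦ s q`. -/
def unitHom {Q : Contra.{u, u} S} (hQ : Contra.IsSeparated Q) :
    Q ⟶ HomFrom.contra hf T (Contra.restrictScalars_separated f hf hQ) where
  toFun q := (Contra.restrictScalars f hf).map ((Contra.evalOne Q).symm q)
  map_act a := by
    have hsep := Contra.restrictScalars_separated f hf hQ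
    refine HomFrom.ext_eval fun t => hsep.eq_of_forall_mk_eq T.basis_I.toHasBasis fun n => ?_
    let φ : FormalSum S Q →+ (Contra.restrictScalars f hf).obj Q ⧸
        ((Contra.restrictScalars f hf).obj Q).timSubmodule (T.I n) :=
      (Submodule.mkQ _).toAddMonoidHom.comp <| (Contra.restrictEquiv hf Q).toAddMonoidHom.comp <|
        (DistribSMul.toAddMonoidHom Q t).comp Q.actHom
    have hφ (b : FormalSum S Q) (hb : b ∈ FormalSum.coeffsIn (T.J n).toAddSubgroup) : φ b = 0 :=
      (Submodule.Quotient.mk_eq_zero _).2 <| (T.restrictEquiv_mem_timSubmodule_iff hf hQ).2 <|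
        Submodule.smul_mem _ t ⟨b, hb, rfl⟩
    refine (FormalSum.map_eq_finsum_of_isOpen (A := (T.J n).toAddSubgroup)
      (T.isOpen_J n) φ hφ a).trans ?_
    refine Eq.trans (finsum_congr fun q => ?_) (HomFrom.mk_eval_act_map T hsep T n _ a t).symm
    have hterm : t • Q.act (a.1 q • FormalSum.single q) = (t * a.1 q) • q := by
      rw [Contra.act_smul, Contra.act_single, mul_smul]
    exact congrArg (fun q => Submodule.Quotient.mk (Contra.restrictEquiv hf Q q)) hterm

/-- The morphism `Hom^R(S, P) → P` taking `h` to `h(1)`. -/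
def counitHom (hP : Contra.IsSeparated P) :
    (Contra.restrictScalars f hf).obj (HomFrom.contra hf T hP) ⟶ P where
  toFun h := HomFrom.eval (hf := hf) h 1
  map_act a := by
    refine hP.eq_of_forall_mk_eq T.basis_I.toHasBasis fun n => ?_
    refine (HomFrom.mk_eval_act T hP T n (FormalSum.mapCoeff f hf a) 1).trans ?_
    refine Eq.trans (finsum_congr fun h => ?_) (Contra.mk_act_map (T.isOpen_I n) _ a).symm
    have heval (r : R) : h.eval (1 * f r) = r • h.eval 1 := by
      rw [one_mul, ← mul_one (f r), HomFrom.eval_map_mul]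
    exact congrArg _ (heval (a.1 h))

variable (hf) in
/-- The adjunction between restriction of scalars and `P ↦ Hom^R(S, P)`. -/
def adjunction : SepContra.restrictScalars f hf ⊣ (T.coextension hf).functor where
  unit :=
    { app := fun Q => ⟨T.unitHom Q.property⟩
      naturality := fun _ _ g => InducedCategory.hom_ext <| Contra.Hom.ext <| funext fun q =>
        HomFrom.ext_eval fun t => (Contra.Hom.map_smul g.hom t q).symm }
  counit :=
    { app := fun P => ⟨T.counitHom P.property⟩
      naturality := fun _ _ _ => rfl }
  left_triangle_components Q := InducedCategory.hom_ext <| Contra.Hom.ext <| funext fun q =>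
    one_smul S (show Q.obj from q)
  right_triangle_components P := InducedCategory.hom_ext <| Contra.Hom.ext <| funext fun h =>
    HomFrom.ext_eval fun t => (HomFrom.eval_smul_apply T P.property t h 1).trans <|
      congrArg _ (one_mul t)

end TautChain

end Coextension

end Contramodules

end

open Contramodules in
theorem mainTheorem6 {R S : Type u}
    [Ring R] [UniformSpace R] [IsUniformAddGroup R] [IsTopologicalRing R]
    [IsLinearTopology R R] [IsLinearTopology Rᵐᵒᵖ R] [CompleteSpace R] [T2Space R]
    [(𝓝 (0 : R)).IsCountablyGenerated]
    [Ring S] [UniformSpace S] [IsUniformAddGroup S] [IsTopologicalRing S]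
    [IsLinearTopology S S] [IsLinearTopology Sᵐᵒᵖ S] [CompleteSpace S] [T2Space S]
    [(𝓝 (0 : S)).IsCountablyGenerated]
    (f : R →+* S) (hf : Continuous f) (hft : StronglyRightTaut f) :
    ∃ C : CoextensionStructure f hf,
      -- The underlying left `S`-module of the contramodule is the usual one.
      (∀ (P : SepContra.{u, u} R) (g h : (C.functor.obj P).obj) (s t : S),
        HomFrom.eval (P := P.obj) (hf := hf) (g + h) t =
          HomFrom.eval (P := P.obj) (hf := hf) g t + HomFrom.eval (P := P.obj) (hf := hf) h t ∧
        HomFrom.eval (P := P.obj) (hf := hf) (s • g) t =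
          HomFrom.eval (P := P.obj) (hf := hf) g (t * s)) ∧
      -- It is the limit of the contramodules `Hom_{Rₙ}(Sₙ, Pₙ)`.
      Nonempty (TautChain f) ∧
      (∀ (T : TautChain f) (P : SepContra.{u, u} R),
        ∃ ρ : ∀ n, (C.functor.obj P).obj ⟶ T.homContra P.obj n,
          (∀ (n : ℕ) (h : HomFrom f hf P.obj) (s : S),
            TautChain.homModule.eval (T := T) (P := P.obj) (ρ n h) (Ideal.Quotient.mk (T.J n) s) =
              Submodule.Quotient.mk (h.eval s)) ∧
          ∀ g : ∀ n, T.homModule P.obj n,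
            (∀ n, T.Compatible P.obj n (g (n + 1)) (g n)) →
              ∃! h : HomFrom f hf P.obj, ∀ n, ρ n h = g n) ∧
      -- It is right adjoint to restriction of scalars, the counit being induced by `f`.
      ∃ adj : SepContra.restrictScalars f hf ⊣ C.functor,
        ∀ (P : SepContra.{u, u} R) (h : HomFrom f hf P.obj),
          Contra.Hom.toFun (adj.counit.app P).hom h =
            Contra.evalOne P.obj (Contra.selfMap f hf ≫ h) := by
  obtain ⟨T₀⟩ := hft.nonempty_tautChain hf
  refine ⟨T₀.coextension hf, fun P g h s t => ?_, ⟨T₀⟩, fun T P => ?_, T₀.adjunction hf,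
    fun P h => ?_⟩
  · exact ⟨HomFrom.eval_add_apply T₀ P.property g h t, HomFrom.eval_smul_apply T₀ P.property s g t⟩
  · exact ⟨HomFrom.reduceHom T₀ P.property T, fun n h s => TautChain.eval_reduce h s,
      TautChain.existsUnique_reduce_eq P.property⟩
  · exact congrArg (Contra.Hom.toFun h) (map_one f).symm
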